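/- Let $k,n$ be nonnegative integers with $2k\le n$, and let $V\subset(\mathbb C^*)^n$ be a complex algebraic variety of dimension $k$, i.e. the set of common zeros in $(\mathbb C^*)^n$ of a set of polynomials in $z_1,\dots,z_n$ with complex coefficients, with $\dim_{\mathbb C}V=k$ ($V$ need be neither irreducible nor equidimensional). Let $$\mathscr A=\mathrm{Log}(V)\subset\mathbb R^n,\qquad \mathrm{Log}(z_1,\dots,z_n)=(\log|z_1|,\dots,\log|z_n|),$$ be its amoeba. Then $\mathscr A$ has finite $2k$-dimensional volume (the $2k$-dimensional Hausdorff measure of $\mathbb R^n$, normalized to be Lebesgue measure on $\mathbb R^{2k}$). In particular this holds for every generic $k$-dimensional variety $V$. -/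

import Mathlib

namespace Amoeba

/-- The complex algebraic torus `(ℂ^*)^n`, as a subset of `ℂ^n`. -/
def complexTorus (n : ℕ) : Set (Fin n → ℂ) :=
  {z | ∀ i, z i ≠ 0}

/-- `V` is an algebraic subvariety of `(ℂ^*)^n`: the set of common zeros in the torus of an ideal
of polynomials. (Laurent polynomials define the same sets, as monomials are units on the torus.) -/
def IsAlgebraicSubvariety {n : ℕ} (V : Set (Fin n → ℂ)) : Prop :=
  ∃ I : Ideal (MvPolynomial (Fin n) ℂ), V = MvPolynomial.zeroLocus ℂ I ∩ complexTorus n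

/-- The complex dimension of a variety `V`: the Krull dimension of the coordinate ring
`ℂ[z_1, …, z_n] / I(V)` of its Zariski closure in `ℂ^n`; it is `⊥` exactly if `V` is empty. -/
noncomputable def dimension {n : ℕ} (V : Set (Fin n → ℂ)) : WithBot ℕ∞ :=
  ringKrullDim (MvPolynomial (Fin n) ℂ ⧸ MvPolynomial.vanishingIdeal ℂ V)

/-- The map `Log (z_1, …, z_n) = (log |z_1|, …, log |z_n|)`, meant for points of the torus, with
values in Euclidean space `ℝ^n`. -/
noncomputable def Log {n : ℕ} (z : Fin n → ℂ) : EuclideanSpace ℝ (Fin n) :=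
  WithLp.toLp 2 fun i => Real.log ‖z i‖

/-- The amoeba of a subset `V` of the torus: its image under `Log`. -/
noncomputable def amoeba {n : ℕ} (V : Set (Fin n → ℂ)) : Set (EuclideanSpace ℝ (Fin n)) :=
  Log '' V

/-- The `d`-dimensional volume of a subset of Euclidean space `ℝ^n`: the `d`-dimensional Hausdorff
measure, normalized so that it is Lebesgue measure on `ℝ^d`. On an embedded `d`-dimensional
submanifold it is the Riemannian volume of the induced metric. -/
noncomputable def vol {n : ℕ} (d : ℕ) (A : Set (EuclideanSpace ℝ (Fin n))) : ENNReal :=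
  MeasureTheory.Measure.euclideanHausdorffMeasure d A

end Amoeba

open Set Filter Topology MeasureTheory
open scoped NNReal ENNReal

/-! In logarithmic coordinates `w = log z` the variety is, on suitable pieces, a complex
`k`-manifold. The amoeba is the image of `w ↦ Re w`, and the arguments are given by `w ↦ Im w`.
Tangent spaces are stable under multiplication by `i` and `Re u = Im (i u)`, so on them the two maps
differ by an automorphism of determinant `±1`. The `2k`-volume of the amoeba is therefore controlled
by volumes of coordinate projections of the arguments, which lie in a bounded box
(`exists_nhds_euclideanHausdorffMeasure_image_le_volume_image`). Points where `Im` is not immersive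
are those where `Re` is not, and a Sard-type lemma makes their image null.

It remains to bound multiplicities. Prescribing `2k` arguments imposes `2k` real linear equations on
`z`; with the equations of the piece this is a square real polynomial system, and a weak Bézout
bound limits its nondegenerate zeros uniformly in the arguments
(`HolomorphicSystem.exists_card_le_ofEtale`).

The pieces come from algebra: a zero locus of dimension at most `k` is covered by finitely many
étale loci over `k` coordinates (`MvPolynomial.zeroLocus_subset_iUnion_etaleLocus`), whatever its
components. -/

/-! ### A weak Bézout bound -/

/-- There are `N + 1` polynomials in `N` variables, so they are algebraically dependent; counting
dimensions also bounds the degree of the relation in `l`. -/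
theorem MvPolynomial.exists_relation_of_card_eq {K σ ρ : Type*} [Field K] [Fintype σ] [Fintype ρ]
    (hcard : Fintype.card ρ = Fintype.card σ) (P : ρ → MvPolynomial σ K) (l : MvPolynomial σ K)
    (d : ℕ) (hP : ∀ r, (P r).totalDegree ≤ d) (hl : l.totalDegree ≤ 1) :
    ∃ c : Fin ((Fintype.card σ * d + 1) ^ Fintype.card σ + 1) → MvPolynomial ρ K,
      c ≠ 0 ∧ ∑ a : Fin ((Fintype.card σ * d + 1) ^ Fintype.card σ + 1), l ^ (a : ℕ) * MvPolynomial.aeval P (c a) = 0 := by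
  classical
  set N := Fintype.card σ with hN
  set A := (N * d + 1) ^ N with hA
  -- A bound for the degree of a product of powers, all exponents at most `A`, of `l` and the `P r`.
  set e := A * (1 + N * d) with he
  let ι := Fin (A + 1) × (ρ → Fin (A + 1))
  let mon : (ρ → Fin (A + 1)) → (ρ →₀ ℕ) := fun b => Finsupp.equivFunOnFinite.symm fun r => (b r : ℕ)
  have hmon : Function.Injective mon := by
    intro b b' h
    have := Finsupp.equivFunOnFinite.symm.injective h
    funext r
    exact Fin.ext (congrFun this r)
  let m : ι → MvPolynomial σ K := fun i => l ^ (i.1 : ℕ) * ∏ r, P r ^ (i.2 r : ℕ)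
  have hm : ∀ i, (m i).totalDegree ≤ e := by
    intro i
    refine (MvPolynomial.totalDegree_mul _ _).trans ?_
    have h1 : (l ^ (i.1 : ℕ)).totalDegree ≤ A := by
      refine (MvPolynomial.totalDegree_pow _ _).trans ?_
      have := i.1.2
      nlinarith
    have h2 : (∏ r, P r ^ (i.2 r : ℕ)).totalDegree ≤ ∑ _r : ρ, A * d := by
      refine (MvPolynomial.totalDegree_finsetProd _ _).trans (Finset.sum_le_sum fun r _ => ?_)
      refine (MvPolynomial.totalDegree_pow _ _).trans ?_
      exact Nat.mul_le_mul (Nat.lt_succ_iff.mp (i.2 r).2) (hP r)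
    rw [Finset.sum_const, Finset.card_univ, hcard, smul_eq_mul] at h2
    rw [he]
    calc _ ≤ A + N * (A * d) := add_le_add h1 h2
      _ = _ := by ring
  let L : (ι → K) →ₗ[K] ((σ → Fin (e + 1)) → K) :=
    { toFun := fun c t => MvPolynomial.coeff (Finsupp.equivFunOnFinite.symm fun s => (t s : ℕ))
        (∑ i, c i • m i)
      map_add' := by
        intro x y; funext t
        simp [add_smul, Finset.sum_add_distrib]
      map_smul' := by
        intro x y; funext t
        simp [mul_smul, ← Finset.smul_sum, MvPolynomial.coeff_sum, Finset.mul_sum] }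
  -- There are `(A + 1) ^ (N + 1)` products but only `(e + 1) ^ N` coefficients to kill. The value
  -- of `A` is chosen so that `e + 1 ≤ (N * d + 1) * (A + 1)` gives `(e + 1) ^ N ≤ A * (A + 1) ^ N`.
  have hker : LinearMap.ker L ≠ ⊥ := by
    apply LinearMap.ker_ne_bot_of_finrank_lt
    rw [Module.finrank_fintype_fun_eq_card, Module.finrank_fintype_fun_eq_card]
    simp only [ι, Fintype.card_prod, Fintype.card_fun, Fintype.card_fin, hcard, ← hN]
    calc (e + 1) ^ N ≤ ((N * d + 1) * (A + 1)) ^ N := by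
          gcongr
          rw [he]; ring_nf; omega
      _ = A * (A + 1) ^ N := by rw [mul_pow]
      _ < _ := by gcongr; omega
  obtain ⟨c, hc, hc0⟩ := (Submodule.ne_bot_iff _).mp hker
  have hsum : ∑ i, c i • m i = 0 := by
    refine MvPolynomial.ext _ _ fun t => ?_
    rw [MvPolynomial.coeff_zero]
    by_cases ht : ∀ s, t s < e + 1
    · have := congrFun (LinearMap.mem_ker.mp hc) (fun s => ⟨t s, ht s⟩)
      have htt : (Finsupp.equivFunOnFinite.symm fun s => t s) = t := by ext s; simp
      rw [← htt]
      exact this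
    · push Not at ht
      obtain ⟨s, hs⟩ := ht
      apply MvPolynomial.coeff_eq_zero_of_totalDegree_lt
      calc _ ≤ e := by
            refine MvPolynomial.totalDegree_finsetSum_le fun i _ => ?_
            exact (MvPolynomial.totalDegree_smul_le _ _).trans (hm i)
        _ < t s := hs
        _ ≤ _ := by
          by_cases h0 : t s = 0
          · simp [h0]
          · exact Finset.single_le_sum (f := fun i => t i) (fun _ _ => Nat.zero_le _) (by simpa using h0)
  refine ⟨fun a => ∑ b, MvPolynomial.monomial (mon b) (c (a, b)), ?_, ?_⟩
  · intro h
    apply hc0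
    funext ⟨a, b⟩
    have := congrArg (MvPolynomial.coeff (mon b)) (congrFun h a)
    simpa [MvPolynomial.coeff_sum, MvPolynomial.coeff_monomial, hmon.eq_iff] using this
  · rw [← hsum, Fintype.sum_prod_type]
    refine Finset.sum_congr rfl fun a _ => ?_
    rw [map_sum, Finset.mul_sum]
    refine Finset.sum_congr rfl fun b _ => ?_
    rw [MvPolynomial.aeval_monomial, Finsupp.prod_fintype _ _ (by simp)]
    simp [m, mon, Algebra.smul_def]
    ring

theorem MvPolynomial.exists_mem_nhds_eval_ne_zero {ρ : Type*} [Fintype ρ] (q : MvPolynomial ρ ℝ)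
    (hq : q ≠ 0) {U : Set (ρ → ℝ)} {x : ρ → ℝ} (hU : U ∈ 𝓝 x) :
    ∃ y ∈ U, MvPolynomial.eval y q ≠ 0 := by
  by_contra! h
  obtain ⟨ε, hε, hb⟩ := Metric.mem_nhds_iff.mp hU
  apply hq
  apply MvPolynomial.funext_set (fun r => Metric.ball (x r) ε)
    (fun r => (Metric.ball_mem_nhds (x r) hε |> infinite_of_mem_nhds (x r)))
  intro y hy
  rw [map_zero]
  apply h y (hb _)
  rw [ball_pi _ hε]
  exact hy

/-- A weak form of Bézout's theorem: a square system of real polynomials of degree at most `d` has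
at most `(N d + 1) ^ N` nondegenerate zeros. -/
theorem MvPolynomial.card_nondegenerate_zeros_le {E σ ρ : Type*} [NormedAddCommGroup E]
    [NormedSpace ℝ E] [CompleteSpace E] [Fintype σ] [Fintype ρ]
    (hcard : Fintype.card ρ = Fintype.card σ)
    (e : E ≃L[ℝ] (σ → ℝ)) (P : ρ → MvPolynomial σ ℝ) (d : ℕ) (hP : ∀ r, (P r).totalDegree ≤ d)
    (Φ : E → ρ → ℝ) (hΦ : ∀ x r, Φ x r = MvPolynomial.eval (e x) (P r)) (Z : Finset E)
    (hZ : ∀ z ∈ Z, Φ z = 0 ∧ ∃ Φ' : E →L[ℝ] (ρ → ℝ), HasStrictFDerivAt Φ Φ' z ∧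
      Function.Injective Φ') :
    Z.card ≤ (Fintype.card σ * d + 1) ^ Fintype.card σ := by
  classical
  -- A linear form separating the zeros turns counting them into counting roots of a one-variable
  -- polynomial.
  obtain ⟨f, hf⟩ : ∃ f : Module.Dual ℝ (σ → ℝ), Set.InjOn (fun z => f (e z)) Z := by
    obtain ⟨f, hf⟩ := Module.exists_dual_forall_apply_ne_zero
      (fun p : {p : Z × Z // p.1 ≠ p.2} => e p.1.1 - e p.1.2) (K := ℝ) (by
        rintro ⟨⟨p, q⟩, h⟩ h0
        exact h (Subtype.ext (e.injective (sub_eq_zero.mp h0))))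
    refine ⟨f, fun z hz w hw h => ?_⟩
    by_contra hne
    refine hf ⟨⟨⟨z, hz⟩, ⟨w, hw⟩⟩, fun h' => hne (congrArg Subtype.val h')⟩ ?_
    rw [map_sub]
    exact sub_eq_zero.mpr h
  let l : MvPolynomial σ ℝ := ∑ s, MvPolynomial.C (f (Pi.single s 1)) * MvPolynomial.X s
  have hl : l.totalDegree ≤ 1 := by
    refine MvPolynomial.totalDegree_finsetSum_le fun s _ => ?_
    refine (MvPolynomial.totalDegree_mul _ _).trans ?_
    simp
  have hlf : ∀ x, MvPolynomial.eval x l = f x := by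
    intro x
    simp only [l, map_sum, map_mul, MvPolynomial.eval_C, MvPolynomial.eval_X]
    conv_rhs => rw [pi_eq_sum_univ' x]
    simp [mul_comm]
  obtain ⟨c, hc, hrel⟩ := MvPolynomial.exists_relation_of_card_eq hcard P l d hP hl
  obtain ⟨a₀, ha₀⟩ := Function.ne_iff.mp hc
  have hfin : FiniteDimensional ℝ E := LinearEquiv.finiteDimensional e.symm.toLinearEquiv
  have hcont : Continuous fun z => f (e z) := f.continuous_of_finiteDimensional.comp e.continuous
  obtain ⟨δ, hδ⟩ : ∃ V : ℝ → Set ℝ, (∀ x ∈ Z.image fun z => f (e z), V x ∈ 𝓝 x) ∧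
      (((Z.image fun z => f (e z)) : Finset ℝ) : Set ℝ).PairwiseDisjoint V := by
    obtain ⟨V, hV, hV'⟩ := (Z.image fun z => f (e z)).finite_toSet.t2_separation
    exact ⟨V, fun x _ => (hV x).2.mem_nhds (hV x).1, hV'⟩
  have hopen : ∀ z ∈ Z, Φ '' ((fun z => f (e z)) ⁻¹' δ (f (e z))) ∈ 𝓝 (0 : ρ → ℝ) := by
    intro z hz
    obtain ⟨h0, Φ', hs, hi⟩ := hZ z hz
    have hsurj : Φ'.range = ⊤ := by
      apply LinearMap.range_eq_top.mpr
      refine (LinearMap.injective_iff_surjective_of_finrank_eq_finrank ?_).mp hi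
      rw [e.toLinearEquiv.finrank_eq]
      simp [hcard]
    rw [← h0, ← hs.map_nhds_eq_of_surj hsurj]
    exact image_mem_map (hcont.continuousAt.preimage_mem_nhds
      (hδ.1 _ (Finset.mem_image_of_mem _ hz)))
  -- At the value `0` the relation might vanish identically. Near a nondegenerate zero `Φ` is open,
  -- so `0` can be replaced by a nearby `y` where a coefficient survives, while every zero persists
  -- as a solution of `Φ = y` and stays separated by `f`.
  obtain ⟨y, hy, hyc⟩ := MvPolynomial.exists_mem_nhds_eval_ne_zero (c a₀) ha₀
    ((Filter.biInter_finset_mem Z).mpr hopen)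
  have hx : ∀ z ∈ Z, ∃ x, f (e x) ∈ δ (f (e z)) ∧ Φ x = y := fun z hz => by
    simpa using mem_iInter₂.mp hy z hz
  choose! x hxδ hxy using hx
  let q : Polynomial ℝ := ∑ a : Fin ((Fintype.card σ * d + 1) ^ Fintype.card σ + 1), Polynomial.monomial (a : ℕ) (MvPolynomial.eval y (c a))
  have hq0 : q ≠ 0 := by
    intro h
    apply hyc
    have := congrArg (fun p => p.coeff (a₀ : ℕ)) h
    simpa [q, Polynomial.finsetSum_coeff, Polynomial.coeff_monomial, Fin.val_inj] using this
  have hqdeg : q.natDegree ≤ (Fintype.card σ * d + 1) ^ Fintype.card σ := by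
    refine Polynomial.natDegree_sum_le_of_forall_le _ _ fun a _ => ?_
    exact (Polynomial.natDegree_monomial_le _).trans (Nat.lt_succ_iff.mp a.2)
  have hroot : ∀ z ∈ Z, q.eval (f (e (x z))) = 0 := by
    intro z hz
    have := congrArg (MvPolynomial.eval (e (x z))) hrel
    rw [map_sum, map_zero] at this
    rw [Polynomial.eval_finsetSum, ← this]
    refine Finset.sum_congr rfl fun a _ => ?_
    have hev : MvPolynomial.eval (e (x z)) (MvPolynomial.aeval P (c a)) =
        MvPolynomial.eval y (c a) := by
      have hyP : y = fun r => MvPolynomial.eval (e (x z)) (P r) := by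
        rw [← hxy z hz]; funext r; exact hΦ _ _
      rw [hyP, MvPolynomial.aeval_def, MvPolynomial.eval₂_eq',
        MvPolynomial.eval_eq' (fun r => MvPolynomial.eval (e (x z)) (P r)) (c a)]
      simp [map_sum, map_prod]
    rw [map_mul, map_pow, hev, hlf, Polynomial.eval_monomial, mul_comm]
  refine le_trans ?_ hqdeg
  refine (Finset.card_le_card_of_injOn (fun z => f (e (x z))) (t := q.roots.toFinset) ?_ ?_).trans
    ((Multiset.toFinset_card_le _).trans (Polynomial.card_roots' q))
  · intro z hz
    simp [hq0, hroot z hz]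
  · intro z hz w hw h
    have h' : f (e (x z)) = f (e (x w)) := h
    by_contra hne
    have hd := hδ.2 (Finset.mem_coe.mpr (Finset.mem_image_of_mem _ hz))
      (Finset.mem_coe.mpr (Finset.mem_image_of_mem _ hw)) (fun h => hne (hf hz hw h))
    exact Set.disjoint_left.mp hd (hxδ z hz) (h' ▸ hxδ w hw)

/-! ### Krull dimension and transcendence degree -/

/-- Lying over starts the chain and going up extends it; control of the last prime is what makes the
induction run. -/
theorem PrimeSpectrum.exists_ltSeries_comap_last_eq {R S : Type*} [CommRing R] [CommRing S]
    [Algebra R S] [Algebra.IsIntegral R S] (hinj : Function.Injective (algebraMap R S)) (m : ℕ) :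
    ∀ p : LTSeries (PrimeSpectrum R), p.length = m →
    ∃ q : LTSeries (PrimeSpectrum S), q.length = m ∧
      PrimeSpectrum.comap (algebraMap R S) q.last = p.last := by
  induction m with
  | zero =>
    intro p _
    obtain ⟨Q, -, hQ, hQP⟩ := Ideal.exists_ideal_over_prime_of_isIntegral (S := S) p.last.asIdeal ⊥
      (by rw [← RingHom.ker_eq_comap_bot, (RingHom.injective_iff_ker_eq_bot _).mp hinj]
          exact bot_le)
    exact ⟨RelSeries.singleton _ ⟨Q, hQ⟩, rfl, PrimeSpectrum.ext hQP⟩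
  | succ m ih =>
    intro p hp
    obtain ⟨q, hq, hqp⟩ := ih p.eraseLast (by simp [hp])
    have hlt : p.eraseLast.last < p.last := p.eraseLast_last_rel_last (by omega)
    obtain ⟨Q, hle, hQ, hQP⟩ := Ideal.exists_ideal_over_prime_of_isIntegral (S := S)
      p.last.asIdeal q.last.asIdeal (by
        have := congrArg PrimeSpectrum.asIdeal hqp
        rw [PrimeSpectrum.comap_asIdeal] at this
        rw [this]
        exact hlt.le)
    refine ⟨q.snoc ⟨Q, hQ⟩ (lt_of_le_of_ne hle ?_), by simp [hq], ?_⟩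
    · intro h
      have h' : q.last = ⟨Q, hQ⟩ := PrimeSpectrum.ext h
      rw [h'] at hqp
      have : p.eraseLast.last = p.last := hqp ▸ PrimeSpectrum.ext hQP
      exact hlt.ne this
    · rw [RelSeries.last_snoc]
      exact PrimeSpectrum.ext hQP

theorem ringKrullDim_le_of_isIntegral {R S : Type*} [CommRing R] [CommRing S]
    [Algebra R S] [Algebra.IsIntegral R S] (hinj : Function.Injective (algebraMap R S)) :
    ringKrullDim R ≤ ringKrullDim S := by
  refine iSup_le fun p => ?_
  obtain ⟨q, hq, -⟩ := PrimeSpectrum.exists_ltSeries_comap_last_eq (S := S) hinj p.length p rfl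
  rw [← hq]
  exact Order.LTSeries.length_le_krullDim q

/-- By Noether normalization `A` is integral over a polynomial ring with the same transcendence
degree, whose dimension is its number of variables. -/
theorem Algebra.trdeg_le_ringKrullDim {K A : Type*} [Field K] [CommRing A] [IsDomain A] [Algebra K A]
    [Algebra.FiniteType K A] (m : ℕ) (hm : (m : Cardinal) ≤ Algebra.trdeg K A) :
    (m : WithBot ℕ∞) ≤ ringKrullDim A := by
  obtain ⟨s, g, hg, hint⟩ := exists_integral_inj_algHom_of_fg K A
  let _ : Algebra (MvPolynomial (Fin s) K) A := g.toRingHom.toAlgebra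
  have _ : IsScalarTower K (MvPolynomial (Fin s) K) A :=
    IsScalarTower.of_algebraMap_eq fun x => (g.commutes x).symm
  have hI : Algebra.IsIntegral (MvPolynomial (Fin s) K) A := ⟨hint⟩
  have hF : FaithfulSMul (MvPolynomial (Fin s) K) A :=
    (faithfulSMul_iff_algebraMap_injective _ _).mpr hg
  have htr : Algebra.trdeg K A = s := by
    have h := lift_trdeg_add_eq K (MvPolynomial (Fin s) K) A
    rw [trdeg_eq_zero (R := MvPolynomial (Fin s) K) (A := A), MvPolynomial.trdeg_of_isDomain] at h
    simpa using h.symm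
  rw [htr, Nat.cast_le] at hm
  refine le_trans ?_ (ringKrullDim_le_of_isIntegral (R := MvPolynomial (Fin s) K) (S := A) hg)
  rw [MvPolynomial.ringKrullDim_of_isNoetherianRing, ringKrullDim_eq_zero_of_field]
  simpa using hm

theorem MvPolynomial.card_le_ringKrullDim_quotient {K σ : Type*} [Field K] [Finite σ]
    (I : Ideal (MvPolynomial σ K)) [I.IsPrime] (J : Finset σ)
    (hJ : ∀ p ∈ I, (p.vars : Set σ) ⊆ J → p = 0) :
    (J.card : WithBot ℕ∞) ≤ ringKrullDim (MvPolynomial σ K ⧸ I) := by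
  apply Algebra.trdeg_le_ringKrullDim (K := K)
  have hind : AlgebraicIndependent K
      (fun j : J => Ideal.Quotient.mk I (MvPolynomial.X (j : σ))) := by
    rw [algebraicIndependent_iff]
    intro q hq
    have h : MvPolynomial.aeval (fun j : J => Ideal.Quotient.mk I (MvPolynomial.X (j : σ))) q =
        Ideal.Quotient.mkₐ K I (MvPolynomial.rename (fun j : J => (j : σ)) q) := by
      rw [← AlgHom.comp_apply]
      congr 1
      ext j
      simp
    rw [h] at hq
    have hmem := Ideal.Quotient.eq_zero_iff_mem.mp hq
    have := hJ _ hmem (by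
      rw [← MvPolynomial.mem_supported (R := K), MvPolynomial.supported_eq_range_rename]
      exact ⟨q, rfl⟩)
    exact MvPolynomial.rename_injective _ Subtype.val_injective (this.trans (map_zero _).symm)
  have := hind.lift_cardinalMk_le_trdeg
  simpa using this

/-! ### Covering a variety by étale loci -/

/-- Take a nonzero element of `I` in the variables `J ∪ {i}` of least degree in `i`. It involves `i`
by `hJ`, so in characteristic zero its derivative is nonzero of smaller degree in `i`, hence outside
`I`. -/
theorem MvPolynomial.exists_mem_prime_pderiv_notMem {K σ : Type*} [Field K] [CharZero K]
    (I : Ideal (MvPolynomial σ K)) (J : Set σ)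
    (hJ : ∀ p ∈ I, (p.vars : Set σ) ⊆ J → p = 0) (i : σ)
    (hi : ∃ p ∈ I, (p.vars : Set σ) ⊆ insert i J ∧ p ≠ 0) :
    ∃ p ∈ I, (p.vars : Set σ) ⊆ insert i J ∧ MvPolynomial.pderiv i p ∉ I := by
  classical
  let S : Set (MvPolynomial σ K) := {p | p ∈ I ∧ (p.vars : Set σ) ⊆ insert i J ∧ p ≠ 0}
  have hS : S.Nonempty := hi
  let p := Function.argminOn (MvPolynomial.degreeOf i) S hS
  obtain ⟨hpI, hpv, hp0⟩ : p ∈ S := Function.argminOn_mem _ _ hS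
  have hsupp : ∀ m ∈ (MvPolynomial.pderiv i p).support, m + Finsupp.single i 1 ∈ p.support := by
    intro m hm
    rw [MvPolynomial.mem_support_iff, MvPolynomial.coeff_pderiv] at hm
    exact MvPolynomial.mem_support_iff.mpr (left_ne_zero_of_mul hm)
  obtain ⟨m, hm, hmi⟩ : ∃ m ∈ p.support, m i ≠ 0 := by
    by_contra! h
    refine hp0 (hJ p hpI fun j hj => ?_)
    rcases hpv hj with rfl | h'
    · obtain ⟨m, hm, hmj⟩ := MvPolynomial.mem_vars_iff_mem_support _ |>.mp hj
      exact absurd (h m hm) (Finsupp.mem_support_iff.mp hmj)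
    · exact h'
  have hdeg : 0 < MvPolynomial.degreeOf i p :=
    (Nat.pos_of_ne_zero hmi).trans_le (MvPolynomial.monomial_le_degreeOf i hm)
  refine ⟨p, hpI, hpv, fun hd => ?_⟩
  have hlt : MvPolynomial.degreeOf i (MvPolynomial.pderiv i p) < MvPolynomial.degreeOf i p := by
    rw [MvPolynomial.degreeOf_lt_iff hdeg]
    intro m hm
    simpa using MvPolynomial.monomial_le_degreeOf i (hsupp m hm)
  refine absurd ?_ (not_le.mpr hlt)
  refine Function.argminOn_le (MvPolynomial.degreeOf i) S (a := MvPolynomial.pderiv i p) ⟨hd, ?_, ?_⟩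
  · intro j hj
    obtain ⟨m, hm, hmj⟩ := MvPolynomial.mem_vars_iff_mem_support _ |>.mp hj
    refine hpv (MvPolynomial.mem_vars_iff_mem_support _ |>.mpr ⟨_, hsupp m hm, ?_⟩)
    rw [Finsupp.mem_support_iff] at hmj ⊢
    rw [Finsupp.add_apply]
    omega
  · intro h
    have h1 := congrArg (MvPolynomial.coeff (m - Finsupp.single i 1)) h
    rw [MvPolynomial.coeff_pderiv, Finsupp.sub_add_single_one_cancel hmi,
      MvPolynomial.coeff_zero] at h1
    exact mul_ne_zero (MvPolynomial.mem_support_iff.mp hm) (Nat.cast_add_one_ne_zero _) h1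

/-- The locus where, for each `i ∉ J`, the polynomial `P i` vanishes and has nonzero `i`-th partial
derivative. -/
def MvPolynomial.etaleLocus {K σ : Type*} [CommRing K] (J : Finset σ) (P : σ → MvPolynomial σ K) :
    Set (σ → K) :=
  {z | ∀ i ∉ J, MvPolynomial.eval z (P i) = 0 ∧
    MvPolynomial.eval z (MvPolynomial.pderiv i (P i)) ≠ 0}

theorem MvPolynomial.mem_zeroLocus_sup_span_singleton {K σ : Type*} [Field K]
    {I : Ideal (MvPolynomial σ K)} {g : MvPolynomial σ K} {z : σ → K}
    (hz : z ∈ MvPolynomial.zeroLocus K I) (hg : MvPolynomial.aeval z g = 0) :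
    z ∈ MvPolynomial.zeroLocus K (I ⊔ Ideal.span {g}) := by
  rw [MvPolynomial.mem_zeroLocus_iff] at hz ⊢
  intro p hp
  obtain ⟨a, ha, b, hb, rfl⟩ := Submodule.mem_sup.mp hp
  obtain ⟨c, rfl⟩ := Ideal.mem_span_singleton'.mp hb
  rw [map_add, map_mul, hz a ha, hg, mul_zero, add_zero]

/-- A largest set of coordinates independent modulo `I` has at most `k` elements, and each other
coordinate satisfies a separable equation over it. The exceptional set lies where the product `g` of
the derivatives vanishes, and `g ∉ I` since `I` is prime. -/
theorem MvPolynomial.exists_prime_zeroLocus_subset {K σ : Type*} [Field K] [CharZero K]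
    [Fintype σ] (k : ℕ) (hk : k ≤ Fintype.card σ) (I : Ideal (MvPolynomial σ K)) [I.IsPrime]
    (hdim : ringKrullDim (MvPolynomial σ K ⧸ I) ≤ k) :
    ∃ (J : Finset σ) (P : σ → MvPolynomial σ K) (g : MvPolynomial σ K), J.card = k ∧
      (∀ i ∉ J, ((P i).vars : Set σ) ⊆ insert i (J : Set σ)) ∧ g ∉ I ∧
      MvPolynomial.zeroLocus K I ⊆ MvPolynomial.etaleLocus J P ∪
        MvPolynomial.zeroLocus K (I ⊔ Ideal.span {g}) := by
  classical
  obtain ⟨J, hJ, hmax⟩ := Finset.exists_max_image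
    (Finset.univ.filter fun J : Finset σ => ∀ p ∈ I, (p.vars : Set σ) ⊆ J → p = 0) Finset.card
    ⟨∅, by
      simp only [Finset.mem_filter, Finset.mem_univ, true_and]
      intro p hp hv
      have hv' : p ∈ (⊥ : Subalgebra K (MvPolynomial σ K)) := by
        rw [← MvPolynomial.supported_empty, MvPolynomial.mem_supported]
        simpa using hv
      obtain ⟨c, rfl⟩ := Algebra.mem_bot.mp hv'
      by_contra hc
      refine ‹I.IsPrime›.ne_top (Ideal.eq_top_of_isUnit_mem _ hp ?_)
      exact (isUnit_iff_ne_zero.mpr fun h => hc (by rw [h, map_zero])).map _⟩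
  simp only [Finset.mem_filter, Finset.mem_univ, true_and] at hJ hmax
  have hP : ∀ i, i ∉ J → ∃ p ∈ I, (p.vars : Set σ) ⊆ insert i (J : Set σ) ∧
      MvPolynomial.pderiv i p ∉ I := by
    intro i hi
    refine MvPolynomial.exists_mem_prime_pderiv_notMem I J hJ i ?_
    by_contra! h
    have := hmax (insert i J) fun p hp hv => h p hp (by simpa using hv)
    rw [Finset.card_insert_of_notMem hi] at this
    omega
  choose! P hPI hPv hPd using hP
  have hcard : J.card ≤ k := by
    exact_mod_cast (MvPolynomial.card_le_ringKrullDim_quotient I J hJ).trans hdim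
  -- Padding to exactly `k` coordinates drops equations, so lower-dimensional components are placed
  -- in loci of dimension `k`.
  obtain ⟨J', hJJ', hJ'⟩ := Finset.exists_superset_card_eq hcard hk
  refine ⟨J', P, ∏ i ∈ Jᶜ, MvPolynomial.pderiv i (P i), hJ', fun i hi => ?_, ?_, ?_⟩
  · exact (hPv i fun h => hi (hJJ' h)).trans (insert_subset_insert (by simpa using hJJ'))
  · rw [Ideal.IsPrime.prod_mem_iff]
    rintro ⟨i, hi, h⟩
    exact hPd i (by simpa using hi) h
  · intro z hz0
    have hz := MvPolynomial.mem_zeroLocus_iff.mp hz0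
    simp only [MvPolynomial.aeval_eq_eval] at hz
    by_cases hg : MvPolynomial.eval z (∏ i ∈ Jᶜ, MvPolynomial.pderiv i (P i)) = 0
    · right
      exact MvPolynomial.mem_zeroLocus_sup_span_singleton hz0 hg
    · left
      intro i hi
      have hi' : i ∉ J := fun h => hi (hJJ' h)
      refine ⟨hz _ (hPI i hi'), fun h => hg ?_⟩
      rw [map_prod]
      exact Finset.prod_eq_zero (by simpa using hi') h

/-- Noetherian induction: a prime ideal contributes one étale locus and a strictly larger ideal; a
proper non-prime one, with `a * b ∈ I`, splits into the ideals obtained by adding `a` and `b`. -/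
theorem MvPolynomial.zeroLocus_subset_iUnion_etaleLocus {K σ : Type*} [Field K] [CharZero K]
    [Fintype σ] (k : ℕ) (hk : k ≤ Fintype.card σ) (I : Ideal (MvPolynomial σ K))
    (hdim : ringKrullDim (MvPolynomial σ K ⧸ I) ≤ k) :
    ∃ T : Set (Finset σ × (σ → MvPolynomial σ K)), T.Finite ∧
      (∀ t ∈ T, t.1.card = k ∧ ∀ i ∉ t.1, ((t.2 i).vars : Set σ) ⊆ insert i (t.1 : Set σ)) ∧
      MvPolynomial.zeroLocus K I ⊆ ⋃ t ∈ T, MvPolynomial.etaleLocus t.1 t.2 := by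
  induction I using WellFoundedGT.induction with
  | ind I ih =>
  have hdim' : ∀ I' ≥ I, ringKrullDim (MvPolynomial σ K ⧸ I') ≤ k := fun I' h =>
    (ringKrullDim_le_of_surjective (Ideal.Quotient.factor h)
      (Ideal.Quotient.factor_surjective h)).trans hdim
  by_cases hprime : I.IsPrime
  · obtain ⟨J, P, g, hJ, hP, hg, hsub⟩ := MvPolynomial.exists_prime_zeroLocus_subset k hk I hdim
    obtain ⟨T, hT, hT1, hT2⟩ := ih (I ⊔ Ideal.span {g})
      (lt_of_le_of_ne le_sup_left fun h => hg (h ▸ Ideal.mem_sup_right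
        (Ideal.mem_span_singleton_self g))) (hdim' _ le_sup_left)
    refine ⟨insert (J, P) T, hT.insert _, ?_, ?_⟩
    · rintro t (rfl | ht)
      · exact ⟨hJ, hP⟩
      · exact hT1 t ht
    · rw [biUnion_insert]
      exact hsub.trans (union_subset_union_right _ hT2)
  by_cases htop : I = ⊤
  · exact ⟨∅, finite_empty, by simp, by simp [htop]⟩
  obtain ⟨a, ha, b, hb, hab⟩ : ∃ a ∉ I, ∃ b ∉ I, a * b ∈ I := by
    by_contra! h
    refine hprime ⟨htop, fun {a b} hab => ?_⟩
    by_contra! h'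
    exact h a h'.1 b h'.2 hab
  have key : ∀ a ∉ I, ∃ T : Set (Finset σ × (σ → MvPolynomial σ K)), T.Finite ∧
      (∀ t ∈ T, t.1.card = k ∧ ∀ i ∉ t.1, ((t.2 i).vars : Set σ) ⊆ insert i (t.1 : Set σ)) ∧
      MvPolynomial.zeroLocus K (I ⊔ Ideal.span {a}) ⊆
        ⋃ t ∈ T, MvPolynomial.etaleLocus t.1 t.2 := fun a ha =>
    ih (I ⊔ Ideal.span {a}) (lt_of_le_of_ne le_sup_left fun h => ha (h ▸ Ideal.mem_sup_right
        (Ideal.mem_span_singleton_self a))) (hdim' _ le_sup_left)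
  obtain ⟨T, hT, hT1, hT2⟩ := key a ha
  obtain ⟨T', hT', hT1', hT2'⟩ := key b hb
  refine ⟨T ∪ T', hT.union hT', fun t ht => ht.elim (hT1 t) (hT1' t), ?_⟩
  rw [biUnion_union]
  refine Subset.trans ?_ (union_subset_union hT2 hT2')
  intro z hz
  rcases mul_eq_zero.mp ((map_mul _ a b).symm.trans
    (MvPolynomial.mem_zeroLocus_iff.mp hz _ hab)) with h | h
  · exact Or.inl (MvPolynomial.mem_zeroLocus_sup_span_singleton hz h)
  · exact Or.inr (MvPolynomial.mem_zeroLocus_sup_span_singleton hz h)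

/-! ### Hausdorff measure of images and multiplicity -/

theorem LipschitzOnWith.euclideanHausdorffMeasure_image_le {X Y : Type*} [EMetricSpace X]
    [MeasurableSpace X] [BorelSpace X] [EMetricSpace Y] [MeasurableSpace Y] [BorelSpace Y]
    {K : ℝ≥0} {f : X → Y} {s : Set X} (h : LipschitzOnWith K f s) (m : ℕ) :
    μHE[m] (f '' s) ≤ (K : ℝ≥0∞) ^ m * μHE[m] s := by
  rw [Measure.euclideanHausdorffMeasure_def, Measure.euclideanHausdorffMeasure_def,
    Measure.smul_apply, Measure.smul_apply, ENNReal.smul_def, ENNReal.smul_def, smul_eq_mul,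
    smul_eq_mul, mul_left_comm]
  gcongr
  simpa using h.hausdorffMeasure_image_le (d := m) (Nat.cast_nonneg m)

/-- After the change of variables `Q` the derivative has norm at most `L`, so `F ∘ Q⁻¹` is locally
`(L + 1)`-Lipschitz; `Q` itself scales volume by `|det Q|`. -/
theorem HasStrictFDerivAt.exists_nhds_euclideanHausdorffMeasure_image_le {m : ℕ} {E : Type*}
    [NormedAddCommGroup E] [NormedSpace ℝ E] [MeasurableSpace E] [BorelSpace E]
    {F : EuclideanSpace ℝ (Fin m) → E} {A : EuclideanSpace ℝ (Fin m) →L[ℝ] E}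
    {x : EuclideanSpace ℝ (Fin m)} (hF : HasStrictFDerivAt F A x)
    (Q : EuclideanSpace ℝ (Fin m) ≃L[ℝ] EuclideanSpace ℝ (Fin m)) (L : ℝ≥0)
    (hA : ∀ v, ‖A v‖ ≤ L * ‖Q v‖) :
    ∃ O ∈ 𝓝 x, ∀ s ⊆ O, μHE[m] (F '' s) ≤
      ((L + 1 : ℝ≥0) : ℝ≥0∞) ^ m * (ENNReal.ofReal
        |(Q : EuclideanSpace ℝ (Fin m) →L[ℝ] EuclideanSpace ℝ (Fin m)).det| * volume s) := by
  set N : ℝ≥0 := ‖(Q.symm : EuclideanSpace ℝ (Fin m) →L[ℝ] EuclideanSpace ℝ (Fin m))‖₊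
  -- With this tolerance the linearization error, measured through `Q`, costs at most `1` in the
  -- Lipschitz constant.
  set c : ℝ≥0 := (N + 1)⁻¹
  have hc : 0 < c := by positivity
  obtain ⟨O, hO, happ⟩ := hF.approximates_deriv_on_nhds (Or.inr hc)
  refine ⟨O, hO, fun s hs => ?_⟩
  have hlip : LipschitzOnWith (L + 1) (F ∘ Q.symm) (Q '' s) := by
    rw [lipschitzOnWith_iff_norm_sub_le]
    rintro _ ⟨y, hy, rfl⟩ _ ⟨z, hz, rfl⟩
    simp only [Function.comp_apply, ContinuousLinearEquiv.symm_apply_apply]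
    have h1 := happ y (hs hy) z (hs hz)
    have h2 : ‖y - z‖ ≤ N * ‖Q (y - z)‖ := by
      have := (Q.symm : EuclideanSpace ℝ (Fin m) →L[ℝ] EuclideanSpace ℝ (Fin m)).le_opNorm
        (Q (y - z))
      simpa [N] using this
    have h3 : (c : ℝ) * N ≤ 1 := by
      have : c * N ≤ 1 := by
        rw [inv_mul_le_iff₀ (by positivity)]; simp
      exact_mod_cast this
    rw [← map_sub]
    calc ‖F y - F z‖ = ‖(F y - F z - A (y - z)) + A (y - z)‖ := by rw [sub_add_cancel]
      _ ≤ ‖F y - F z - A (y - z)‖ + ‖A (y - z)‖ := norm_add_le _ _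
      _ ≤ c * (N * ‖Q (y - z)‖) + L * ‖Q (y - z)‖ := by
          refine add_le_add (h1.trans ?_) (hA _)
          gcongr
      _ ≤ 1 * ‖Q (y - z)‖ + L * ‖Q (y - z)‖ := by
          rw [← mul_assoc]
          gcongr
      _ = _ := by push_cast; ring
  have himg : F '' s = (F ∘ Q.symm) '' (Q '' s) := by
    rw [image_image]; simp
  rw [himg]
  refine (hlip.euclideanHausdorffMeasure_image_le m).trans ?_
  rw [EuclideanSpace.euclideanHausdorffMeasure_eq_volume]
  gcongr
  exact (Measure.addHaar_image_continuousLinearMap volume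
    (Q : EuclideanSpace ℝ (Fin m) →L[ℝ] EuclideanSpace ℝ (Fin m)) s).le

theorem exists_disjoint_measurable_cover {X : Type*} [TopologicalSpace X]
    [SecondCountableTopology X] [MeasurableSpace X] [OpensMeasurableSpace X] {s : Set X}
    {U : X → Set X} (hU : ∀ x ∈ s, U x ∈ 𝓝 x) :
    ∃ D : ℕ → Set X, Pairwise (Function.onFun Disjoint D) ∧ (∀ i, MeasurableSet (D i)) ∧
      (∀ i, D i = ∅ ∨ ∃ x ∈ s, D i ⊆ U x) ∧ s ⊆ ⋃ i, D i := by
  obtain ⟨t, hts, htc, hst⟩ := TopologicalSpace.countable_cover_nhdsWithin (s := s)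
    (f := fun x => interior (U x))
    fun x hx => mem_nhdsWithin_of_mem_nhds (interior_mem_nhds.mpr (hU x hx))
  rcases t.eq_empty_or_nonempty with rfl | hne
  · exact ⟨fun _ => ∅, fun _ _ _ => disjoint_bot_left, by simp, by simp, by simpa using hst⟩
  obtain ⟨e, rfl⟩ := htc.exists_eq_range hne
  refine ⟨disjointed fun i => interior (U (e i)), disjoint_disjointed _,
    fun i => MeasurableSet.disjointed (fun i => isOpen_interior.measurableSet) i,
    fun i => Or.inr ⟨e i, hts (mem_range_self i),
      (disjointed_subset _ i).trans interior_subset⟩, ?_⟩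
  rw [iUnion_disjointed]
  simpa using hst

/-- A Sard-type statement: shrinking a kernel direction by `ε` leaves the derivative's values
unchanged but makes `det Q = ε`, so images of bounded pieces have measure `O(ε)`. -/
theorem euclideanHausdorffMeasure_image_degenerate_eq_zero {m : ℕ} {E : Type*}
    [NormedAddCommGroup E] [NormedSpace ℝ E] [MeasurableSpace E] [BorelSpace E]
    {F : EuclideanSpace ℝ (Fin m) → E} {F' : EuclideanSpace ℝ (Fin m) →
      EuclideanSpace ℝ (Fin m) →L[ℝ] E} {Z : Set (EuclideanSpace ℝ (Fin m))}
    (hF : ∀ x ∈ Z, HasStrictFDerivAt F (F' x) x) (hZ : ∀ x ∈ Z, ¬ Function.Injective (F' x)) :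
    μHE[m] (F '' Z) = 0 := by
  have hcov : Z ⊆ ⋃ M : ℕ, {x ∈ Z | ‖F' x‖ ≤ M ∧ ‖x‖ ≤ M} := by
    intro x hx
    obtain ⟨M, hM⟩ := exists_nat_ge (max ‖F' x‖ ‖x‖)
    exact mem_iUnion.mpr ⟨M, hx, (le_max_left _ _).trans hM, (le_max_right _ _).trans hM⟩
  refine measure_mono_null (image_mono hcov) ?_
  rw [image_iUnion, measure_iUnion_null_iff]
  intro M
  set S := {x ∈ Z | ‖F' x‖ ≤ M ∧ ‖x‖ ≤ M}
  set B := Metric.closedBall (0 : EuclideanSpace ℝ (Fin m)) M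
  have hSB : S ⊆ B := fun x hx => by simpa [B] using hx.2.2
  have hBfin : volume B ≠ ∞ := measure_closedBall_lt_top.ne
  have key : ∀ ε : ℝ≥0, 0 < ε →
      μHE[m] (F '' S) ≤ ((M + 1 : ℝ≥0) : ℝ≥0∞) ^ m * (ε * volume B) := by
    intro ε hε
    have hloc : ∀ x ∈ S, ∃ O ∈ 𝓝 x, ∀ s ⊆ O, μHE[m] (F '' s) ≤
        ((M + 1 : ℝ≥0) : ℝ≥0∞) ^ m * (ε * volume s) := by
      intro x hx
      obtain ⟨v, hv, hv0⟩ : ∃ v, F' x v = 0 ∧ v ≠ 0 := by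
        by_contra! h
        exact hZ x hx.1 ((injective_iff_map_eq_zero _).mpr h)
      obtain ⟨f, hf⟩ : ∃ f : Module.Dual ℝ (EuclideanSpace ℝ (Fin m)), f v = 1 := by
        obtain ⟨f, hf⟩ := SeparatingDual.exists_eq_one (R := ℝ) hv0
        exact ⟨f.toLinearMap, hf⟩
      set T := LinearMap.transvection ((ε - 1 : ℝ) • f) v
      have hdet : LinearMap.det T = ε := by
        rw [LinearMap.transvection.det]
        simp [hf]
      let Q : EuclideanSpace ℝ (Fin m) ≃L[ℝ] EuclideanSpace ℝ (Fin m) :=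
        (LinearEquiv.ofIsUnitDet (f := T) (v := (EuclideanSpace.basisFun (Fin m) ℝ).toBasis)
          (v' := (EuclideanSpace.basisFun (Fin m) ℝ).toBasis) (by
            rw [LinearMap.det_toMatrix, hdet]
            exact isUnit_iff_ne_zero.mpr (by positivity))).toContinuousLinearEquiv
      have hQ : ∀ w, Q w = T w := fun w => rfl
      obtain ⟨O, hO, h⟩ := (hF x hx.1).exists_nhds_euclideanHausdorffMeasure_image_le Q M (by
        intro w
        have : F' x w = F' x (Q w) := by
          rw [hQ, LinearMap.transvection.apply, map_add, map_smul, hv, smul_zero, add_zero]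
        rw [this]
        refine ((F' x).le_opNorm _).trans ?_
        gcongr
        exact_mod_cast hx.2.1)
      refine ⟨O, hO, fun s hs => (h s hs).trans (le_of_eq ?_)⟩
      have hdQ : (Q : EuclideanSpace ℝ (Fin m) →L[ℝ] EuclideanSpace ℝ (Fin m)).det = ε := hdet
      rw [hdQ]
      simp
    choose! O hO hOs using hloc
    obtain ⟨D, hDd, hDm, hDO, hSD⟩ := exists_disjoint_measurable_cover hO
    calc μHE[m] (F '' S) ≤ μHE[m] (⋃ i, F '' (D i ∩ S)) := by
          rw [← image_iUnion, ← iUnion_inter]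
          exact measure_mono (image_mono fun x hx => ⟨hSD hx, hx⟩)
      _ ≤ ∑' i, μHE[m] (F '' (D i ∩ S)) := measure_iUnion_le _
      _ ≤ ∑' i, ((M + 1 : ℝ≥0) : ℝ≥0∞) ^ m * (ε * volume (D i ∩ B)) := by
          refine ENNReal.tsum_le_tsum fun i => ?_
          refine le_trans ?_ (by gcongr : _ * (_ * volume (D i ∩ S)) ≤ _)
          rcases hDO i with h | ⟨x, hx, h⟩
          · simp [h]
          · exact hOs x hx _ (inter_subset_left.trans h)
      _ = ((M + 1 : ℝ≥0) : ℝ≥0∞) ^ m * (ε * volume (⋃ i, D i ∩ B)) := by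
          rw [ENNReal.tsum_mul_left, ENNReal.tsum_mul_left, measure_iUnion]
          · exact fun i j hij => (hDd hij).mono inter_subset_left inter_subset_left
          · exact fun i => (hDm i).inter Metric.isClosed_closedBall.measurableSet
      _ ≤ _ := by
          gcongr
          exact iUnion_subset fun i => inter_subset_right
  by_contra hne
  have hpos : 0 < μHE[m] (F '' S) := pos_iff_ne_zero.mpr hne
  have hC : ((M + 1 : ℝ≥0) : ℝ≥0∞) ^ m * volume B ≠ ∞ :=
    ENNReal.mul_ne_top (ENNReal.pow_ne_top ENNReal.coe_ne_top) hBfin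
  obtain ⟨ε, hε, hlt⟩ := ENNReal.exists_nnreal_pos_mul_lt hC hne
  refine absurd (key ε hε) (not_le.mpr ?_)
  rwa [mul_left_comm]

/-- The sum is the integral of the number of pieces whose image contains `θ`. The pieces being
disjoint, this number is bounded by the size of a fibre. -/
theorem tsum_volume_image_le_of_card_le {X : Type*} [Nonempty X] {m : ℕ} {A : ℕ → Set X}
    (hA : Pairwise (Function.onFun Disjoint A)) {g : X → EuclideanSpace ℝ (Fin m)}
    (hg : ∀ i, MeasurableSet (g '' A i)) {K : Set (EuclideanSpace ℝ (Fin m))}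
    (hK : MeasurableSet K) (hgK : ∀ i, g '' A i ⊆ K) (N : ℕ)
    (hN : ∀ θ, ∀ Z : Finset X, (∀ z ∈ Z, (∃ i, z ∈ A i) ∧ g z = θ) → Z.card ≤ N) :
    ∑' i, volume (g '' A i) ≤ N * volume K := by
  classical
  have h1 : ∀ i, volume (g '' A i) = ∫⁻ θ, (g '' A i).indicator 1 θ := fun i =>
    (lintegral_indicator_one (hg i)).symm
  simp_rw [h1]
  rw [← lintegral_tsum fun i => (measurable_one.indicator (hg i)).aemeasurable,
    ← lintegral_indicator_const hK]
  refine lintegral_mono fun θ => ?_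
  by_cases hθ : θ ∈ K
  · rw [indicator_of_mem hθ]
    refine ENNReal.tsum_le_of_sum_range_le fun n => ?_
    have h2 : ∀ i, (g '' A i).indicator (1 : EuclideanSpace ℝ (Fin m) → ℝ≥0∞) θ = if θ ∈ g '' A i then 1 else 0 :=
      fun i => by simp [indicator_apply]
    simp_rw [h2]
    rw [Finset.sum_boole]
    have h3 : ∀ i, θ ∈ g '' A i → ∃ z, z ∈ A i ∧ g z = θ := fun i h => h
    choose! z hz using h3
    have h4 : ((Finset.range n).filter fun i => θ ∈ g '' A i).card ≤ N := by
      rw [← Finset.card_image_of_injOn (f := z)]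
      · apply hN θ
        intro y hy
        obtain ⟨i, hi, rfl⟩ := Finset.mem_image.mp hy
        have := hz i (Finset.mem_filter.mp hi).2
        exact ⟨⟨i, this.1⟩, this.2⟩
      · intro i hi j hj hij
        by_contra hne
        have h5 := (hz i (Finset.mem_filter.mp hi).2).1
        have h6 := (hz j (Finset.mem_filter.mp hj).2).1
        exact disjoint_left.mp (hA hne) h5 (hij ▸ h6)
    exact_mod_cast h4
  · have h2 : ∀ i, θ ∉ g '' A i := fun i h => hθ (hgK i h)
    simp [h2, hθ]

/-! ### Coordinate minors and comparison of real and imaginary parts -/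

/-- The linear map selecting the coordinates `I 0, …, I (m - 1)` of a vector. -/
noncomputable def coordSelect {m n : ℕ} (I : Fin m → Fin n) :
    EuclideanSpace ℝ (Fin n) →L[ℝ] EuclideanSpace ℝ (Fin m) :=
  LinearMap.toContinuousLinearMap
    { toFun := fun x => WithLp.toLp 2 fun a => x (I a)
      map_add' := fun _ _ => rfl
      map_smul' := fun _ _ => rfl }

@[simp]
theorem coordSelect_apply {m n : ℕ} (I : Fin m → Fin n) (x : EuclideanSpace ℝ (Fin n)) (a : Fin m) :
    coordSelect I x a = x (I a) := rfl

theorem exists_injective_coordSelect {m n : ℕ}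
    (A : EuclideanSpace ℝ (Fin m) →L[ℝ] EuclideanSpace ℝ (Fin n)) (hA : Function.Injective A) :
    ∃ I : Fin m → Fin n, Function.Injective ((coordSelect I).comp A) := by
  let l : Fin n → Module.Dual ℝ (EuclideanSpace ℝ (Fin m)) := fun j =>
    ((EuclideanSpace.proj j).comp A).toLinearMap
  have hl : ∀ v, (∀ j, l j v = 0) → v = 0 := fun v hv =>
    (injective_iff_map_eq_zero _).mp hA v (by ext j; exact hv j)
  have hspan : Submodule.span ℝ (range l) = ⊤ := by
    rw [eq_top_iff]
    rintro f -
    refine mem_span_of_iInf_ker_le_ker fun v hv => ?_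
    rw [hl v fun j => LinearMap.mem_ker.mp (Submodule.mem_iInf _ |>.mp hv j)]
    exact Submodule.zero_mem _
  have hrank : Module.finrank ℝ (Submodule.span ℝ (range l)) = m := by
    rw [hspan, finrank_top, Subspace.dual_finrank_eq]
    simp
  have hbasis := Submodule.exists_fun_fin_finrank_span_eq ℝ (range l)
  rw [hrank] at hbasis
  obtain ⟨f, hf, hfs, -⟩ := hbasis
  choose I hI using hf
  refine ⟨I, (injective_iff_map_eq_zero _).mpr fun v hv => hl v fun j => ?_⟩
  have hj : l j ∈ Submodule.span ℝ (range f) := hfs ▸ Submodule.subset_span (mem_range_self j)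
  have hle : Submodule.span ℝ (range f) ≤
      LinearMap.ker (Module.Dual.eval ℝ (EuclideanSpace ℝ (Fin m)) v) := by
    rw [Submodule.span_le]
    rintro _ ⟨a, rfl⟩
    have : (coordSelect I (A v)) a = 0 := by
      have := congrArg (fun x : EuclideanSpace ℝ (Fin m) => x a) hv
      simpa using this
    rw [SetLike.mem_coe, LinearMap.mem_ker, Module.Dual.eval_apply, ← hI a]
    exact this
  exact hle hj

theorem Matrix.det_one_updateRow {R ι : Type*} [CommRing R] [Fintype ι] [DecidableEq ι] (a : ι)
    (c : ι → R) : ((1 : Matrix ι ι R).updateRow a c).det = c a := by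
  rw [← Matrix.det_transpose, ← Matrix.updateCol_transpose, Matrix.transpose_one,
    ← Matrix.cramer_apply, Matrix.cramer_one]
  rfl

theorem EuclideanSpace.norm_le_sum_abs {n : ℕ} (x : EuclideanSpace ℝ (Fin n)) :
    ‖x‖ ≤ ∑ j, |x j| := by
  conv_lhs => rw [← (EuclideanSpace.basisFun (Fin n) ℝ).sum_repr x]
  refine (norm_sum_le _ _).trans (le_of_eq ?_)
  simp [norm_smul]

/-- Choose the `m × m` minor of largest absolute value. By Cramer's rule each entry of `A Q⁻¹` is a
quotient of another minor by it, hence at most `1` in absolute value. -/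
theorem exists_dominating_coordSelect {m n : ℕ}
    (A : EuclideanSpace ℝ (Fin m) →L[ℝ] EuclideanSpace ℝ (Fin n)) (hA : Function.Injective A) :
    ∃ (I : Fin m → Fin n) (Q : EuclideanSpace ℝ (Fin m) ≃L[ℝ] EuclideanSpace ℝ (Fin m)),
      (Q : EuclideanSpace ℝ (Fin m) →L[ℝ] EuclideanSpace ℝ (Fin m)) = (coordSelect I).comp A ∧
      ∀ v, ‖A v‖ ≤ (n * m : ℕ) * ‖Q v‖ := by
  obtain ⟨I₀, hI₀⟩ := exists_injective_coordSelect A hA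
  have hdet₀ : ((coordSelect I₀).comp A).det ≠ 0 :=
    (LinearEquiv.isUnit_det' (LinearEquiv.ofInjectiveEndo
      ((coordSelect I₀).comp A).toLinearMap hI₀)).ne_zero
  have : Nonempty (Fin m → Fin n) := ⟨I₀⟩
  obtain ⟨I, hI⟩ := Finite.exists_max fun I : Fin m → Fin n => |((coordSelect I).comp A).det|
  have hdet : ((coordSelect I).comp A).det ≠ 0 :=
    abs_pos.mp ((abs_pos.mpr hdet₀).trans_le (hI I₀))
  let Q := ((coordSelect I).comp A).toContinuousLinearEquivOfDetNeZero hdet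
  have hQ : (Q : EuclideanSpace ℝ (Fin m) →L[ℝ] EuclideanSpace ℝ (Fin m)) =
    (coordSelect I).comp A := ContinuousLinearMap.coe_toContinuousLinearEquivOfDetNeZero _ _
  refine ⟨I, Q, hQ, ?_⟩
  let B := A.comp (Q.symm : EuclideanSpace ℝ (Fin m) →L[ℝ] EuclideanSpace ℝ (Fin m))
  have hBA : ∀ v, A v = B (Q v) := fun v => by simp [B]
  have hBI : ∀ w a, B w (I a) = w a := fun w a => by
    have h := congrArg (fun f => f (Q.symm w)) hQ
    simp only [ContinuousLinearEquiv.coe_coe, ContinuousLinearEquiv.apply_symm_apply] at h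
    exact (congrArg (fun x : EuclideanSpace ℝ (Fin m) => x a) h).symm
  let b := EuclideanSpace.basisFun (Fin m) ℝ
  have hc : ∀ j a, |B (b a) j| ≤ 1 := by
    intro j a
    have hmat : LinearMap.toMatrix b.toBasis b.toBasis
        ((coordSelect (Function.update I a j)).comp B).toLinearMap =
        (1 : Matrix (Fin m) (Fin m) ℝ).updateRow a fun s => B (b s) j := by
      ext r s
      have h1 : LinearMap.toMatrix b.toBasis b.toBasis
        ((coordSelect (Function.update I a j)).comp B).toLinearMap r s =
          B (b s) (Function.update I a j r) := by
        simp [LinearMap.toMatrix_apply, b]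
      rw [h1]
      by_cases hr : r = a
      · subst hr; simp
      · rw [Function.update_of_ne hr, hBI, Matrix.updateRow_ne hr]
        simp [b, Matrix.one_apply]
    have h2 : ((coordSelect (Function.update I a j)).comp B).det = B (b a) j := by
      rw [ContinuousLinearMap.det, ← LinearMap.det_toMatrix b.toBasis, hmat,
        Matrix.det_one_updateRow]
    have h3 : (coordSelect (Function.update I a j)).comp A =
        ((coordSelect (Function.update I a j)).comp B).comp
          (Q : EuclideanSpace ℝ (Fin m) →L[ℝ] EuclideanSpace ℝ (Fin m)) := by
      ext1 v
      simp [B]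
    have h4 := hI (Function.update I a j)
    simp only [h3] at h4
    rw [← hQ] at h4
    have h5 : (((coordSelect (Function.update I a j)).comp B).comp
        (Q : EuclideanSpace ℝ (Fin m) →L[ℝ] EuclideanSpace ℝ (Fin m))).det = B (b a) j *
        (Q : EuclideanSpace ℝ (Fin m) →L[ℝ] EuclideanSpace ℝ (Fin m)).det := by
      rw [← h2]
      exact LinearMap.det_comp _ _
    rw [h5, abs_mul] at h4
    rw [← hQ] at hdet
    exact le_of_mul_le_mul_right (by rwa [one_mul]) (abs_pos.mpr hdet)
  intro v
  rw [hBA]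
  generalize Q v = w
  have h6 : ∀ j, |B w j| ≤ m * ‖w‖ := by
    intro j
    have : B w j = ∑ a, w a * B (b a) j := by
      conv_lhs => rw [← b.sum_repr w]
      simp [b]
    rw [this]
    calc |∑ a, w a * B (b a) j| ≤ ∑ a, |w a * B (b a) j| := Finset.abs_sum_le_sum_abs _ _
      _ ≤ ∑ _a : Fin m, ‖w‖ := by
          refine Finset.sum_le_sum fun a _ => ?_
          rw [abs_mul]
          exact (mul_le_of_le_one_right (abs_nonneg _) (hc j a)).trans (PiLp.norm_apply_le w a)
      _ = m * ‖w‖ := by simp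
  calc ‖B w‖ ≤ ∑ j, |B w j| := EuclideanSpace.norm_le_sum_abs _
    _ ≤ ∑ _j : Fin n, m * ‖w‖ := Finset.sum_le_sum fun j _ => h6 j
    _ = _ := by simp [mul_assoc]

/-- Since `J² = -1` forces `|det J| = 1`, the dominant minor of the derivative of `F` has the
absolute value of the same minor for `G`. The former bounds the measure of the image from above, the
latter bounds volume from below. -/
theorem exists_nhds_euclideanHausdorffMeasure_image_le_volume_image {m n : ℕ}
    {F G : EuclideanSpace ℝ (Fin m) → EuclideanSpace ℝ (Fin n)}
    {G' : EuclideanSpace ℝ (Fin m) →L[ℝ] EuclideanSpace ℝ (Fin n)}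
    {J : EuclideanSpace ℝ (Fin m) →L[ℝ] EuclideanSpace ℝ (Fin m)} {x : EuclideanSpace ℝ (Fin m)}
    (hF : HasStrictFDerivAt F (G'.comp J) x) (hG : HasStrictFDerivAt G G' x)
    (hJ : J.comp J = -ContinuousLinearMap.id ℝ _) (hinj : Function.Injective G') :
    ∃ I : Fin m → Fin n, Function.Injective ((coordSelect I).comp G') ∧
      ∃ O ∈ 𝓝 x, InjOn (fun y => coordSelect I (G y)) O ∧
      ∀ s ⊆ O, μHE[m] (F '' s) ≤
        2 * (((n * m : ℕ) : ℝ≥0) + 1 : ℝ≥0) ^ m * volume ((fun y => coordSelect I (G y)) '' s) := by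
  have hJJ : ∀ v, J (J v) = -v := fun v => congrArg (fun f => f v) hJ
  have hJinj : Function.Injective J := fun v w h => by
    have := congrArg J h
    rw [hJJ, hJJ] at this
    exact neg_injective this
  obtain ⟨I, Q, hQ, hbound⟩ := exists_dominating_coordSelect (G'.comp J) (hinj.comp hJinj)
  obtain ⟨O₁, hO₁, h₁⟩ := hF.exists_nhds_euclideanHausdorffMeasure_image_le Q ((n * m : ℕ) : ℝ≥0)
    (by simpa using hbound)
  have hdetJ : |J.det| = 1 := by
    have h : J.det * J.det = (-ContinuousLinearMap.id ℝ (EuclideanSpace ℝ (Fin m))).det := by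
      rw [← hJ]; exact (LinearMap.det_comp _ _).symm
    have h' : (-ContinuousLinearMap.id ℝ (EuclideanSpace ℝ (Fin m))).det = (-1) ^ m := by
      have : (-ContinuousLinearMap.id ℝ (EuclideanSpace ℝ (Fin m))).toLinearMap =
        (-1 : ℝ) • LinearMap.id := by ext; simp
      rw [ContinuousLinearMap.det, this, LinearMap.det_smul]
      simp
    have h'' : |J.det| * |J.det| = 1 := by
      rw [← abs_mul, h, h', abs_pow, abs_neg, abs_one, one_pow]
    nlinarith [abs_nonneg J.det]
  let M := (coordSelect I).comp G'
  have hMdet : |(Q : EuclideanSpace ℝ (Fin m) →L[ℝ] EuclideanSpace ℝ (Fin m)).det| = |M.det| := by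
    have : (Q : EuclideanSpace ℝ (Fin m) →L[ℝ] EuclideanSpace ℝ (Fin m)).det = M.det * J.det := by
      rw [hQ]; exact LinearMap.det_comp M.toLinearMap J.toLinearMap
    rw [this, abs_mul, hdetJ, mul_one]
  have hQdet : (Q : EuclideanSpace ℝ (Fin m) →L[ℝ] EuclideanSpace ℝ (Fin m)).det ≠ 0 :=
    (LinearEquiv.isUnit_det' Q.toLinearEquiv).ne_zero
  have hM0 : M.det ≠ 0 := abs_pos.mp (hMdet ▸ abs_pos.mpr hQdet)
  let Me := M.toContinuousLinearEquivOfDetNeZero hM0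
  have hMe : (Me : EuclideanSpace ℝ (Fin m) →L[ℝ] EuclideanSpace ℝ (Fin m)) = M :=
    ContinuousLinearMap.coe_toContinuousLinearEquivOfDetNeZero _ _
  have hGI : HasStrictFDerivAt (fun y => coordSelect I (G y)) M x :=
    (coordSelect I).hasStrictFDerivAt.comp x hG
  have hGIe : HasStrictFDerivAt (fun y => coordSelect I (G y))
    (Me : EuclideanSpace ℝ (Fin m) →L[ℝ] EuclideanSpace ℝ (Fin m)) x := by rwa [hMe]
  -- The lower volume bound needs a constant strictly below `|det M|`; taking half of it produces
  -- the factor `2`.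
  let r : ℝ≥0 := ⟨|M.det| / 2, by positivity⟩
  have hr : (r : ℝ≥0∞) = ENNReal.ofReal (|M.det| / 2) :=
    (ENNReal.ofReal_eq_coe_nnreal _).symm
  have hr0 : 0 < |M.det| := abs_pos.mpr hM0
  obtain ⟨δ, hδ, hδ0⟩ := ((mul_le_addHaar_image_of_lt_det volume M (m := r) (by
      rw [hr, ENNReal.ofReal_lt_ofReal_iff hr0]; linarith)).and
    self_mem_nhdsWithin).exists
  obtain ⟨O₂, hO₂, h₂⟩ := hGI.approximates_deriv_on_nhds (Or.inr hδ0)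
  let e := hGIe.toOpenPartialHomeomorph _
  refine ⟨I, ?_, O₁ ∩ O₂ ∩ e.source, inter_mem (inter_mem hO₁ hO₂)
    (e.open_source.mem_nhds hGIe.mem_toOpenPartialHomeomorph_source), ?_, fun s hs => ?_⟩
  · change Function.Injective M
    rw [← hMe]; exact Me.injective
  · exact e.injOn.mono inter_subset_right
  · refine (h₁ s fun y hy => (hs hy).1.1).trans ?_
    have h3 := hδ s _ (h₂.mono_set fun y hy => (hs hy).1.2)
    have h4 : ENNReal.ofReal
        |(Q : EuclideanSpace ℝ (Fin m) →L[ℝ] EuclideanSpace ℝ (Fin m)).det| = 2 * r := by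
      rw [hMdet, hr, two_mul, ← ENNReal.ofReal_add (by positivity) (by positivity), add_halves]
    rw [h4]
    calc _ = 2 * (((n * m : ℕ) : ℝ≥0) + 1 : ℝ≥0) ^ m * (r * volume s) := by ring
      _ ≤ _ := by gcongr

/-! ### Complex manifolds in logarithmic coordinates -/

/-- The componentwise real part, with values in Euclidean space. -/
noncomputable def reMap (n : ℕ) : (Fin n → ℂ) →L[ℝ] EuclideanSpace ℝ (Fin n) :=
  LinearMap.toContinuousLinearMap
    { toFun := fun w => WithLp.toLp 2 fun i => (w i).re
      map_add' := fun _ _ => by ext; simp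
      map_smul' := fun _ _ => by ext; simp }

/-- The componentwise imaginary part, with values in Euclidean space. -/
noncomputable def imMap (n : ℕ) : (Fin n → ℂ) →L[ℝ] EuclideanSpace ℝ (Fin n) :=
  LinearMap.toContinuousLinearMap
    { toFun := fun w => WithLp.toLp 2 fun i => (w i).im
      map_add' := fun _ _ => by ext; simp
      map_smul' := fun _ _ => by ext; simp }

@[simp]
theorem reMap_apply {n : ℕ} (w : Fin n → ℂ) (i : Fin n) : reMap n w i = (w i).re := rfl

@[simp]
theorem imMap_apply {n : ℕ} (w : Fin n → ℂ) (i : Fin n) : imMap n w i = (w i).im := rfl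

theorem imMap_I_smul {n : ℕ} (w : Fin n → ℂ) : imMap n (Complex.I • w) = reMap n w := by
  ext i; simp

/-- A holomorphic system `g = 0` on `ℂ^n` with `n - k` equations, indexed by the complement of `J`,
which on the open set `U` can be solved locally for the coordinates outside `J`. -/
structure HolomorphicSystem (n k : ℕ) where
  J : Finset (Fin n)
  card_J : J.card = k
  g : (Fin n → ℂ) → Fin n → ℂ
  g' : (Fin n → ℂ) → (Fin n → ℂ) →L[ℂ] Fin n → ℂ
  U : Set (Fin n → ℂ)
  g_apply : ∀ w, ∀ i ∈ J, g w i = 0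
  g'_apply : ∀ w u, ∀ i ∈ J, g' w u i = 0
  hasStrictFDerivAt : ∀ w, HasStrictFDerivAt g (g' w) w
  continuous_g' : Continuous g'
  isOpen_U : IsOpen U
  eq_zero : ∀ w ∈ U, ∀ u, g' w u = 0 → (∀ i ∈ J, u i = 0) → u = 0

namespace HolomorphicSystem

variable {n k : ℕ} (H : HolomorphicSystem n k)

/-- The solution manifold of the system. -/
def locus : Set (Fin n → ℂ) := {w | w ∈ H.U ∧ H.g w = 0}

/-- Extension by zero of the coordinates in `J`. -/
noncomputable def extend : (H.J → ℂ) →L[ℂ] (Fin n → ℂ) :=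
  LinearMap.toContinuousLinearMap
    { toFun := fun y i => if h : i ∈ H.J then y ⟨i, h⟩ else 0
      map_add' := fun _ _ => by ext i; by_cases h : i ∈ H.J <;> simp [h]
      map_smul' := fun _ _ => by ext i; by_cases h : i ∈ H.J <;> simp [h] }

theorem extend_apply (y : H.J → ℂ) (i : Fin n) :
    H.extend y i = if h : i ∈ H.J then y ⟨i, h⟩ else 0 := rfl

/-- Restriction to the coordinates in `J`. -/
noncomputable def restr : (Fin n → ℂ) →L[ℂ] (H.J → ℂ) :=
  LinearMap.toContinuousLinearMap
    { toFun := fun u j => u j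
      map_add' := fun _ _ => rfl
      map_smul' := fun _ _ => rfl }

theorem restr_apply (u : Fin n → ℂ) (j : H.J) : H.restr u j = u j := rfl

theorem restr_extend (y : H.J → ℂ) : H.restr (H.extend y) = y := by
  ext j; simp [restr_apply, extend_apply]

theorem injective_extend_comp_restr_add {w : Fin n → ℂ} (hw : w ∈ H.U) :
    Function.Injective (H.extend.comp H.restr + H.g' w) := by
  refine (injective_iff_map_eq_zero _).mpr fun u hu => ?_
  have hJ : ∀ i ∈ H.J, u i = 0 := fun i hi => by
    simpa [extend_apply, hi, restr_apply, H.g'_apply w u i hi] using congrFun hu i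
  refine H.eq_zero w hw u ?_ hJ
  have : H.extend (H.restr u) = 0 := by
    ext i
    by_cases hi : i ∈ H.J
    · simp [extend_apply, hi, restr_apply, hJ i hi]
    · simp [extend_apply, hi]
  simpa [this] using hu

/-- The derivative of the map `w ↦ (w_J, g w)`, as an equivalence. -/
noncomputable def chartDeriv {w : Fin n → ℂ} (hw : w ∈ H.U) : (Fin n → ℂ) ≃L[ℂ] (Fin n → ℂ) :=
  (LinearEquiv.ofInjectiveEndo (H.extend.comp H.restr + H.g' w).toLinearMap
    (H.injective_extend_comp_restr_add hw)).toContinuousLinearEquiv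

theorem coe_chartDeriv {w : Fin n → ℂ} (hw : w ∈ H.U) :
    (H.chartDeriv hw : (Fin n → ℂ) →L[ℂ] (Fin n → ℂ)) = H.extend.comp H.restr + H.g' w := rfl

/-- The chart is the local inverse of `w ↦ (w_J, g w)` restricted to the slice where the second
block is zero. Its derivative respects multiplication by `i` and has image the kernel of `g'`. -/
theorem exists_chart {w₀ : Fin n → ℂ} (hw₀ : w₀ ∈ H.locus)
    (e : EuclideanSpace ℝ (Fin (2 * k)) ≃L[ℝ] (H.J → ℂ)) :
    ∃ (φ : EuclideanSpace ℝ (Fin (2 * k)) → Fin n → ℂ)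
      (φ' : EuclideanSpace ℝ (Fin (2 * k)) → EuclideanSpace ℝ (Fin (2 * k)) →L[ℝ] Fin n → ℂ)
      (x₀ : EuclideanSpace ℝ (Fin (2 * k))) (O : Set (EuclideanSpace ℝ (Fin (2 * k)))),
      O ∈ 𝓝 x₀ ∧ φ x₀ = w₀ ∧
      (∀ x ∈ O, φ x ∈ H.locus ∧ HasStrictFDerivAt φ (φ' x) x ∧ Function.Injective (φ' x) ∧
        (∀ v, φ' x (e.symm (Complex.I • e v)) = Complex.I • φ' x v) ∧
        ∀ u, H.g' (φ x) u = 0 ↔ ∃ v, φ' x v = u) ∧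
      ∀ O' ∈ 𝓝 x₀, ∃ N ∈ 𝓝 w₀, H.locus ∩ N ⊆ φ '' O' := by
  classical
  have hd : ∀ w (hw : w ∈ H.U), HasStrictFDerivAt (fun w => H.extend (H.restr w) + H.g w)
      (H.chartDeriv hw : (Fin n → ℂ) →L[ℂ] (Fin n → ℂ)) w := fun w hw => by
    rw [coe_chartDeriv]
    exact (H.extend.comp H.restr).hasStrictFDerivAt.add (H.hasStrictFDerivAt w)
  let f := ((hd w₀ hw₀.1).toOpenPartialHomeomorph _).restrOpen H.U H.isOpen_U
  have hfU : ∀ w ∈ f.source, w ∈ H.U := fun w hw => hw.2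
  have hfe : ∀ w, f w = H.extend (H.restr w) + H.g w := fun w => rfl
  have hw₀f : w₀ ∈ f.source := ⟨(hd w₀ hw₀.1).mem_toOpenPartialHomeomorph_source, hw₀.1⟩
  have hfl : ∀ w ∈ H.locus, f w = H.extend (H.restr w) := fun w hw => by
    rw [hfe, hw.2, add_zero]
  let L : EuclideanSpace ℝ (Fin (2 * k)) →L[ℝ] (Fin n → ℂ) :=
    (H.extend.restrictScalars ℝ).comp (e : EuclideanSpace ℝ (Fin (2 * k)) →L[ℝ] (H.J → ℂ))
  have hL : ∀ x, L x = H.extend (e x) := fun x => rfl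
  let O := L ⁻¹' f.target
  have hOU : ∀ x ∈ O, f.symm (L x) ∈ H.U := fun x hx => hfU _ (f.map_target hx)
  let φ : EuclideanSpace ℝ (Fin (2 * k)) → Fin n → ℂ := fun x => f.symm (L x)
  let φ' : EuclideanSpace ℝ (Fin (2 * k)) → EuclideanSpace ℝ (Fin (2 * k)) →L[ℝ] Fin n → ℂ :=
    fun x => if hx : x ∈ O then
      (((H.chartDeriv (hOU x hx)).symm : (Fin n → ℂ) →L[ℂ] (Fin n → ℂ)).restrictScalars ℝ).comp L
      else 0
  have hφ' : ∀ x (hx : x ∈ O), ∀ v, φ' x v = (H.chartDeriv (hOU x hx)).symm (H.extend (e v)) :=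
    fun x hx v => by simp only [φ', dif_pos hx]; rfl
  have hx₀ : L (e.symm (H.restr w₀)) = f w₀ := by
    rw [hL, e.apply_symm_apply, hfl _ hw₀]
  refine ⟨φ, φ', e.symm (H.restr w₀), O, ?_, ?_, ?_, ?_⟩
  · refine L.continuous.continuousAt.preimage_mem_nhds (f.open_target.mem_nhds ?_)
    rw [hx₀]
    exact f.map_source hw₀f
  · simp only [φ]
    rw [hx₀, f.left_inv hw₀f]
  · intro x hx
    have hfφ : H.extend (H.restr (φ x)) + H.g (φ x) = H.extend (e x) := f.right_inv hx
    refine ⟨⟨hOU x hx, ?_⟩, ?_, ?_, ?_, ?_⟩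
    · ext i
      by_cases hi : i ∈ H.J
      · exact H.g_apply _ i hi
      · simpa [extend_apply, hi] using congrFun hfφ i
    · have h1 : HasStrictFDerivAt f.symm
          ((H.chartDeriv (hOU x hx)).symm : (Fin n → ℂ) →L[ℂ] (Fin n → ℂ)) (L x) :=
        f.hasStrictFDerivAt_symm hx (hd _ (hOU x hx))
      have h2 := (h1.restrictScalars ℝ).comp x L.hasStrictFDerivAt
      simp only [φ', dif_pos hx]
      exact h2
    · refine (injective_iff_map_eq_zero _).mpr fun v hv => ?_
      rw [hφ' x hx, ContinuousLinearEquiv.map_eq_zero_iff] at hv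
      have := congrArg H.restr hv
      rw [restr_extend, map_zero] at this
      exact e.map_eq_zero_iff.mp this
    · intro v
      rw [hφ' x hx, hφ' x hx, e.apply_symm_apply, map_smul, map_smul]
    · intro u
      constructor
      · intro hu
        refine ⟨e.symm (H.restr u), ?_⟩
        rw [hφ' x hx, e.apply_symm_apply, ContinuousLinearEquiv.symm_apply_eq]
        change _ = (H.extend.comp H.restr + H.g' (φ x)) u
        simp [hu]
      · rintro ⟨v, rfl⟩
        have h1 : (H.extend.comp H.restr + H.g' (φ x)) (φ' x v) = H.extend (e v) := by
          rw [hφ' x hx]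
          exact (H.chartDeriv (hOU x hx)).apply_symm_apply _
        ext i
        by_cases hi : i ∈ H.J
        · exact H.g'_apply _ _ i hi
        · simpa [extend_apply, hi] using congrFun h1 i
  · intro O' hO'
    have hc : ContinuousAt (fun w => e.symm (H.restr w)) w₀ :=
      (e.symm.continuous.comp H.restr.continuous).continuousAt
    refine ⟨f.source ∩ (fun w => e.symm (H.restr w)) ⁻¹' O',
      inter_mem (f.open_source.mem_nhds hw₀f) (hc.preimage_mem_nhds hO'), ?_⟩
    rintro w ⟨hw, hwf, hwO⟩
    refine ⟨e.symm (H.restr w), hwO, ?_⟩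
    simp only [φ]
    rw [hL, e.apply_symm_apply, ← hfl w hw, f.left_inv hwf]

theorem exists_realCoordinates :
    Nonempty (EuclideanSpace ℝ (Fin (2 * k)) ≃L[ℝ] (H.J → ℂ)) := by
  refine ⟨ContinuousLinearEquiv.ofFinrankEq ?_⟩
  rw [finrank_euclideanSpace_fin, Module.finrank_pi_fintype]
  simp [H.card_J, mul_comm]

/-- The complex structure transported to real coordinates. -/
noncomputable def complexStructure (e : EuclideanSpace ℝ (Fin (2 * k)) ≃L[ℝ] (H.J → ℂ)) :
    EuclideanSpace ℝ (Fin (2 * k)) →L[ℝ] EuclideanSpace ℝ (Fin (2 * k)) :=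
  (e.symm : (H.J → ℂ) →L[ℝ] EuclideanSpace ℝ (Fin (2 * k))).comp
    ((Complex.I • ContinuousLinearMap.id ℝ (H.J → ℂ)).comp
      (e : EuclideanSpace ℝ (Fin (2 * k)) →L[ℝ] (H.J → ℂ)))

theorem complexStructure_apply (e : EuclideanSpace ℝ (Fin (2 * k)) ≃L[ℝ] (H.J → ℂ))
    (v : EuclideanSpace ℝ (Fin (2 * k))) :
    H.complexStructure e v = e.symm (Complex.I • e v) := rfl

theorem complexStructure_comp_self (e : EuclideanSpace ℝ (Fin (2 * k)) ≃L[ℝ] (H.J → ℂ)) :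
    (H.complexStructure e).comp (H.complexStructure e) = -ContinuousLinearMap.id ℝ _ := by
  ext1 v
  simp [complexStructure_apply, smul_smul]

/-- The points of the locus at which the imaginary parts are immersive on the tangent space. -/
def regularLocus : Set (Fin n → ℂ) :=
  {w | w ∈ H.locus ∧ ∀ u, H.g' w u = 0 → imMap n u = 0 → u = 0}

/-- If a nonzero tangent vector `u` has zero imaginary part, then the tangent vector `i u` has zero
real part, so `Re` is degenerate there and the Sard-type lemma applies in charts. -/
theorem euclideanHausdorffMeasure_reMap_image_diff_eq_zero :
    μHE[2 * k] (reMap n '' (H.locus \ H.regularLocus)) = 0 := by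
  obtain ⟨e⟩ := H.exists_realCoordinates
  -- Pulling the outer measure back along `Re` allows nullity of the image to be checked locally on
  -- the locus.
  have h : (OuterMeasure.comap (reMap n) (μHE[2 * k] : Measure _).toOuterMeasure)
      (H.locus \ H.regularLocus) = 0 := by
    refine measure_null_of_locally_null _ fun w₀ hw₀ => ?_
    obtain ⟨φ, φ', x₀, O, hO, -, hφ, hN⟩ := H.exists_chart hw₀.1 e
    obtain ⟨N, hN, hsub⟩ := hN O hO
    refine ⟨(H.locus \ H.regularLocus) ∩ N,
      inter_mem self_mem_nhdsWithin (mem_nhdsWithin_of_mem_nhds hN), ?_⟩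
    rw [OuterMeasure.comap_apply]
    have hZ := euclideanHausdorffMeasure_image_degenerate_eq_zero
      (F := fun x => reMap n (φ x)) (F' := fun x => (reMap n).comp (φ' x))
      (Z := {x ∈ O | φ x ∉ H.regularLocus})
      (fun x hx => (reMap n).hasStrictFDerivAt.comp x (hφ x hx.1).2.1) (fun x hx hinj => by
        obtain ⟨hloc, -, -, hI, hker⟩ := hφ x hx.1
        refine hx.2 ⟨hloc, fun u hu hu0 => ?_⟩
        obtain ⟨v, rfl⟩ := (hker u).mp hu
        have h1 : (reMap n).comp (φ' x) (e.symm (Complex.I • e v)) = 0 := by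
          rw [ContinuousLinearMap.comp_apply, ← imMap_I_smul, hI, smul_smul, Complex.I_mul_I,
            neg_one_smul, map_neg, hu0, neg_zero]
        have h2 := (injective_iff_map_eq_zero _).mp hinj _ h1
        rw [ContinuousLinearEquiv.map_eq_zero_iff, smul_eq_zero] at h2
        rw [e.map_eq_zero_iff.mp (h2.resolve_left Complex.I_ne_zero), map_zero])
    refine measure_mono_null ?_ hZ
    rintro _ ⟨w, ⟨⟨hwl, hwr⟩, hwN⟩, rfl⟩
    obtain ⟨x, hx, rfl⟩ := hsub ⟨hwl, hwN⟩
    exact ⟨x, ⟨hx, hwr⟩, rfl⟩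
  rwa [OuterMeasure.comap_apply] at h

/-- The coordinates `I` of the imaginary part are a local coordinate system of the locus at `w`. -/
def IsTransverse (I : Fin (2 * k) → Fin n) (w : Fin n → ℂ) : Prop :=
  ∀ u, H.g' w u = 0 → coordSelect I (imMap n u) = 0 → u = 0

theorem isOpen_setOf_isTransverse (I : Fin (2 * k) → Fin n) : IsOpen {w | H.IsTransverse I w} := by
  let L : (Fin n → ℂ) → (Fin n → ℂ) →L[ℝ] (Fin n → ℂ) × EuclideanSpace ℝ (Fin (2 * k)) :=
    fun w => ((H.g' w).restrictScalars ℝ).prod ((coordSelect I).comp (imMap n))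
  have hL : Continuous L := by
    have h1 : Continuous fun w => (H.g' w).restrictScalars ℝ :=
      (ContinuousLinearMap.restrictScalarsL ℂ (Fin n → ℂ) (Fin n → ℂ) ℝ ℝ).continuous.comp
        H.continuous_g'
    exact (ContinuousLinearMap.prodₗᵢ ℝ).continuous.comp (h1.prodMk continuous_const)
  have : {w | H.IsTransverse I w} = L ⁻¹' {f | Function.Injective f} := by
    ext w
    rw [mem_ofPred_eq, mem_preimage, mem_ofPred_eq, injective_iff_map_eq_zero]
    simp [L, IsTransverse]
  rw [this]
  exact ContinuousLinearMap.isOpen_injective.preimage hL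

theorem exists_nhds_isTransverse {w₀ : Fin n → ℂ} (hw₀ : w₀ ∈ H.regularLocus) :
    ∃ I : Fin (2 * k) → Fin n, ∃ N ∈ 𝓝 w₀, (∀ w ∈ N, H.IsTransverse I w) ∧
      InjOn (fun w => coordSelect I (imMap n w)) (H.locus ∩ N) ∧
      ∀ A ⊆ H.locus ∩ N, μHE[2 * k] (reMap n '' A) ≤
        2 * (((n * (2 * k) : ℕ) : ℝ≥0) + 1 : ℝ≥0) ^ (2 * k) *
          volume ((fun w => coordSelect I (imMap n w)) '' A) := by
  obtain ⟨e⟩ := H.exists_realCoordinates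
  obtain ⟨φ, φ', x₀, O, hO, rfl, hφ, hN⟩ := H.exists_chart hw₀.1 e
  obtain ⟨-, hd, hinj, hI, hker⟩ := hφ x₀ (mem_of_mem_nhds hO)
  have hG : HasStrictFDerivAt (fun x => imMap n (φ x)) ((imMap n).comp (φ' x₀)) x₀ :=
    (imMap n).hasStrictFDerivAt.comp x₀ hd
  have hF : HasStrictFDerivAt (fun x => reMap n (φ x))
      (((imMap n).comp (φ' x₀)).comp (H.complexStructure e)) x₀ := by
    have h : ((imMap n).comp (φ' x₀)).comp (H.complexStructure e) = (reMap n).comp (φ' x₀) := by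
      ext1 v
      simp only [ContinuousLinearMap.comp_apply]
      rw [complexStructure_apply, hI, imMap_I_smul]
    rw [h]
    exact (reMap n).hasStrictFDerivAt.comp x₀ hd
  obtain ⟨I, hIinj, O', hO', hO'inj, hO'm⟩ :=
    exists_nhds_euclideanHausdorffMeasure_image_le_volume_image hF hG
      (H.complexStructure_comp_self e)
      ((injective_iff_map_eq_zero _).mpr fun v hv => (injective_iff_map_eq_zero _).mp hinj v
        (hw₀.2 _ ((hker _).mpr ⟨v, rfl⟩) hv))
  obtain ⟨N, hN, hsub⟩ := hN O' hO'
  have htr : H.IsTransverse I (φ x₀) := by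
    intro u hu hu0
    obtain ⟨v, rfl⟩ := (hker u).mp hu
    rw [(injective_iff_map_eq_zero _).mp hIinj v hu0, map_zero]
  refine ⟨I, N ∩ {w | H.IsTransverse I w},
    inter_mem hN ((H.isOpen_setOf_isTransverse I).mem_nhds htr), fun w hw => hw.2, ?_, ?_⟩
  · rintro w ⟨hw, hwN, -⟩ w' ⟨hw', hwN', -⟩ h
    obtain ⟨x, hx, rfl⟩ := hsub ⟨hw, hwN⟩
    obtain ⟨x', hx', rfl⟩ := hsub ⟨hw', hwN'⟩
    rw [hO'inj hx hx' h]
  · intro A hA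
    have hAφ : A = φ '' (O' ∩ φ ⁻¹' A) := by
      rw [image_inter_preimage]
      exact (inter_eq_right.mpr fun w hw => hsub ⟨(hA hw).1, (hA hw).2.1⟩).symm
    have := hO'm (O' ∩ φ ⁻¹' A) inter_subset_left
    rw [hAφ, image_image, image_image]
    exact this

end HolomorphicSystem

/-! ### Finiteness from bounded fibres over the argument box -/

/-- The vectors whose components have imaginary part in `(-π, π]`. -/
def argBox (n : ℕ) : Set (Fin n → ℂ) := {w | ∀ i, (w i).im ∈ Ioc (-Real.pi) Real.pi}

theorem measurableSet_argBox (n : ℕ) : MeasurableSet (argBox n) := by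
  have : argBox n = ⋂ i, (fun w : Fin n → ℂ => (w i).im) ⁻¹' Ioc (-Real.pi) Real.pi := by
    ext w; simp [argBox]
  rw [this]
  exact MeasurableSet.iInter fun i =>
    (Complex.measurable_im.comp (measurable_pi_apply i)) measurableSet_Ioc

namespace HolomorphicSystem

variable {n k : ℕ} (H : HolomorphicSystem n k)

theorem measurableSet_locus : MeasurableSet H.locus := by
  have hg : Continuous H.g := continuous_iff_continuousAt.mpr fun w =>
    (H.hasStrictFDerivAt w).continuousAt
  exact H.isOpen_U.measurableSet.inter (isClosed_singleton.preimage hg).measurableSet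

/-- Cut the regular part into disjoint pieces on each of which some `I` dominates. For each of the
finitely many `I`, the projected argument volumes sum to at most `N` times the volume of a ball. -/
theorem euclideanHausdorffMeasure_reMap_image_lt_top (N : ℕ)
    (hN : ∀ (I : Fin (2 * k) → Fin n) (θ : EuclideanSpace ℝ (Fin (2 * k)))
      (Z : Finset (Fin n → ℂ)), (∀ z ∈ Z, z ∈ H.locus ∩ argBox n ∧ H.IsTransverse I z ∧
        coordSelect I (imMap n z) = θ) → Z.card ≤ N) :
    μHE[2 * k] (reMap n '' (H.locus ∩ argBox n)) < ∞ := by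
  classical
  set T := H.locus ∩ argBox n
  have hTm : MeasurableSet T := H.measurableSet_locus.inter (measurableSet_argBox n)
  have hsub : reMap n '' T ⊆ reMap n '' (H.locus \ H.regularLocus) ∪
      reMap n '' (T ∩ H.regularLocus) := by
    rw [← image_union]
    refine image_mono fun w hw => ?_
    by_cases h : w ∈ H.regularLocus
    · exact Or.inr ⟨hw, h⟩
    · exact Or.inl ⟨hw.1, h⟩
  refine (measure_mono hsub).trans_lt ((measure_union_le _ _).trans_lt ?_)
  rw [H.euclideanHausdorffMeasure_reMap_image_diff_eq_zero, zero_add]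
  set C : ℝ≥0∞ := 2 * (((n * (2 * k) : ℕ) : ℝ≥0) + 1 : ℝ≥0) ^ (2 * k)
  have hCtop : C ≠ ∞ := ENNReal.mul_ne_top (by simp) (ENNReal.pow_ne_top ENNReal.coe_ne_top)
  let P : (Fin (2 * k) → Fin n) → Set (Fin n → ℂ) → Prop := fun I M =>
    (∀ w ∈ M, H.IsTransverse I w) ∧ InjOn (fun w => coordSelect I (imMap n w)) (H.locus ∩ M) ∧
      ∀ A ⊆ H.locus ∩ M, μHE[2 * k] (reMap n '' A) ≤
        C * volume ((fun w => coordSelect I (imMap n w)) '' A)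
  have hloc : ∀ w ∈ T ∩ H.regularLocus, ∃ M ∈ 𝓝 w, ∃ I, P I M := fun w hw => by
    obtain ⟨I, M, hM, h⟩ := H.exists_nhds_isTransverse hw.2
    exact ⟨M, hM, I, h⟩
  choose! M hM hMP using hloc
  obtain ⟨D, hDd, hDm, hDM, hcov⟩ := exists_disjoint_measurable_cover hM
  let A : ℕ → Set (Fin n → ℂ) := fun i => T ∩ D i
  have hAcov : T ∩ H.regularLocus ⊆ ⋃ i, A i := by
    rw [← inter_iUnion]
    exact fun w hw => ⟨hw.1, hcov hw⟩
  have hA : ∀ i, A i = ∅ ∨ ∃ I M, P I M ∧ A i ⊆ H.locus ∩ M := fun i => by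
    rcases hDM i with h | ⟨w, hw, h⟩
    · left; simp [A, h]
    · obtain ⟨I, hI⟩ := hMP w hw
      exact Or.inr ⟨I, M w, hI, fun z hz => ⟨hz.1.1, h hz.2⟩⟩
  -- A piece is kept for every admissible `I` and emptied for the others; overcounting is harmless.
  let AI : (Fin (2 * k) → Fin n) → ℕ → Set (Fin n → ℂ) := fun I i =>
    if ∃ M, P I M ∧ A i ⊆ H.locus ∩ M then A i else ∅
  have hAI : ∀ I i, AI I i ⊆ A i := fun I i => by
    by_cases h : ∃ M, P I M ∧ A i ⊆ H.locus ∩ M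
    · simp only [AI, if_pos h, subset_rfl]
    · simp only [AI, if_neg h, empty_subset]
  have hAIP : ∀ I i, AI I i = ∅ ∨ ∃ M, P I M ∧ AI I i ⊆ H.locus ∩ M := fun I i => by
    by_cases h : ∃ M, P I M ∧ A i ⊆ H.locus ∩ M
    · right; simpa only [AI, if_pos h] using h
    · left; simp only [AI, if_neg h]
  have hAIm : ∀ I i, MeasurableSet (AI I i) := fun I i => by
    by_cases h : ∃ M, P I M ∧ A i ⊆ H.locus ∩ M
    · simpa only [AI, if_pos h] using hTm.inter (hDm i)
    · simp only [AI, if_neg h, MeasurableSet.empty]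
  let K := Metric.closedBall (0 : EuclideanSpace ℝ (Fin (2 * k))) ((2 * k : ℕ) * Real.pi)
  have hI : ∀ I : Fin (2 * k) → Fin n,
      ∑' i, volume ((fun w => coordSelect I (imMap n w)) '' AI I i) ≤ N * volume K := by
    intro I
    apply tsum_volume_image_le_of_card_le
    · exact fun i j hij => (hDd hij).mono ((hAI I i).trans inter_subset_right)
        ((hAI I j).trans inter_subset_right)
    · intro i
      rcases hAIP I i with h | ⟨M, hP, h⟩
      · simp [h]
      · exact (hAIm I i).image_of_continuousOn_injOn
          ((coordSelect I).continuous.comp (imMap n).continuous).continuousOn (hP.2.1.mono h)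
    · exact Metric.isClosed_closedBall.measurableSet
    · rintro i _ ⟨w, hw, rfl⟩
      rw [mem_closedBall_zero_iff]
      refine (EuclideanSpace.norm_le_sum_abs _).trans ?_
      have : ∀ a, |coordSelect I (imMap n w) a| ≤ Real.pi := fun a =>
        abs_le.mpr ⟨((hAI I i hw).1.2 (I a)).1.le, ((hAI I i hw).1.2 (I a)).2⟩
      refine (Finset.sum_le_sum fun a _ => this a).trans (by simp)
    · intro θ Z hZ
      refine hN I θ Z fun z hz => ?_
      obtain ⟨⟨i, hi⟩, hzθ⟩ := hZ z hz
      rcases hAIP I i with h | ⟨M, hP, h⟩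
      · rw [h] at hi; exact hi.elim
      · exact ⟨(hAI I i hi).1, hP.1 z (h hi).2, hzθ⟩
  calc μHE[2 * k] (reMap n '' (T ∩ H.regularLocus)) ≤ ∑' i, μHE[2 * k] (reMap n '' A i) := by
        refine (measure_mono (image_mono hAcov)).trans ?_
        rw [image_iUnion]
        exact measure_iUnion_le _
    _ ≤ ∑' i, ∑ I, C * volume ((fun w => coordSelect I (imMap n w)) '' AI I i) := by
        refine ENNReal.tsum_le_tsum fun i => ?_
        rcases hA i with h | ⟨I, M, hP, h⟩
        · simp [h]
        · refine (hP.2.2 _ h).trans ?_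
          have hAIi : AI I i = A i := if_pos ⟨M, hP, h⟩
          rw [← hAIi]
          exact Finset.single_le_sum (f := fun I =>
            C * volume ((fun w => coordSelect I (imMap n w)) '' AI I i))
            (fun _ _ => zero_le) (Finset.mem_univ I)
    _ = ∑ I, C * ∑' i, volume ((fun w => coordSelect I (imMap n w)) '' AI I i) := by
        rw [Summable.tsum_finsetSum fun _ _ => ENNReal.summable]
        simp_rw [ENNReal.tsum_mul_left]
    _ ≤ ∑ _I : Fin (2 * k) → Fin n, C * (N * volume K) :=
        Finset.sum_le_sum fun I _ => by gcongr; exact hI I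
    _ < ∞ := by
        refine ENNReal.sum_lt_top.mpr fun _ _ => ?_
        exact ENNReal.mul_lt_top hCtop.lt_top
          (ENNReal.mul_lt_top (by simp) measure_closedBall_lt_top)

end HolomorphicSystem

/-! ### Étale loci as holomorphic systems and real polynomial systems -/

/-- The differential of a polynomial at the point `z`. -/
noncomputable def MvPolynomial.differential {𝕜 σ : Type*} [NontriviallyNormedField 𝕜] [Fintype σ]
    (p : MvPolynomial σ 𝕜) (z : σ → 𝕜) : (σ → 𝕜) →L[𝕜] 𝕜 :=
  ∑ j, MvPolynomial.eval z (MvPolynomial.pderiv j p) • ContinuousLinearMap.proj j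

theorem MvPolynomial.differential_apply {𝕜 σ : Type*} [NontriviallyNormedField 𝕜] [Fintype σ]
    (p : MvPolynomial σ 𝕜) (z u : σ → 𝕜) : p.differential z u =
      ∑ j, MvPolynomial.eval z (MvPolynomial.pderiv j p) * u j := by
  simp [MvPolynomial.differential]

theorem MvPolynomial.hasStrictFDerivAt_eval {𝕜 σ : Type*} [NontriviallyNormedField 𝕜] [Fintype σ]
    (p : MvPolynomial σ 𝕜) (z : σ → 𝕜) :
    HasStrictFDerivAt (fun z => MvPolynomial.eval z p) (p.differential z) z := by
  classical
  induction p using MvPolynomial.induction_on with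
  | C a =>
    convert hasStrictFDerivAt_const a z using 1
    · simp
    · ext1 u; simp [MvPolynomial.differential_apply]
  | add p q hp hq =>
    have h : (fun z => MvPolynomial.eval z (p + q)) =
        (fun z => MvPolynomial.eval z p) + fun z => MvPolynomial.eval z q := by ext; simp
    rw [h]
    refine (hp.add hq).congr_fderiv ?_
    ext1 u
    simp [MvPolynomial.differential_apply, add_mul, Finset.sum_add_distrib]
  | mul_X p i hp =>
    have h : (fun z => MvPolynomial.eval z (p * MvPolynomial.X i)) =
        (fun z => MvPolynomial.eval z p) * fun z => z i := by ext; simp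
    rw [h]
    refine (hp.mul (hasStrictFDerivAt_apply i z)).congr_fderiv ?_
    have hpd : ∀ j, MvPolynomial.eval z (MvPolynomial.pderiv j (p * MvPolynomial.X i)) =
        (if j = i then MvPolynomial.eval z p else 0) +
          MvPolynomial.eval z (MvPolynomial.pderiv j p) * z i := fun j => by
      rw [MvPolynomial.pderiv_mul]
      by_cases hj : j = i
      · subst hj; simp [add_comm]
      · simp [hj, Ne.symm hj]
    ext1 u
    simp only [MvPolynomial.differential_apply, hpd, add_mul, Finset.sum_add_distrib, ite_mul,
      zero_mul, Finset.sum_ite_eq', Finset.mem_univ, if_true,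
      add_apply, smul_apply, smul_eq_mul, Finset.mul_sum,
      ContinuousLinearMap.proj_apply]
    congr 1
    exact Finset.sum_congr rfl fun j _ => by ring

/-- Real and imaginary parts of a complex vector, as real coordinates. -/
noncomputable def realCoordinates (n : ℕ) : (Fin n → ℂ) ≃L[ℝ] (Fin n ⊕ Fin n → ℝ) :=
  LinearEquiv.toContinuousLinearEquiv
    { toFun := fun z => Sum.elim (fun i => (z i).re) (fun i => (z i).im)
      map_add' := fun _ _ => by ext (i | i) <;> simp
      map_smul' := fun _ _ => by ext (i | i) <;> simp
      invFun := fun x i => ⟨x (Sum.inl i), x (Sum.inr i)⟩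
      left_inv := fun _ => rfl
      right_inv := fun _ => by ext (i | i) <;> rfl }

@[simp]
theorem realCoordinates_inl {n : ℕ} (z : Fin n → ℂ) (i : Fin n) :
    realCoordinates n z (Sum.inl i) = (z i).re := rfl

@[simp]
theorem realCoordinates_inr {n : ℕ} (z : Fin n → ℂ) (i : Fin n) :
    realCoordinates n z (Sum.inr i) = (z i).im := rfl

theorem MvPolynomial.exists_re_im {n : ℕ} (p : MvPolynomial (Fin n) ℂ) :
    ∃ R S : MvPolynomial (Fin n ⊕ Fin n) ℝ, ∀ z,
      (MvPolynomial.eval z p).re = MvPolynomial.eval (realCoordinates n z) R ∧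
      (MvPolynomial.eval z p).im = MvPolynomial.eval (realCoordinates n z) S := by
  induction p using MvPolynomial.induction_on with
  | C a => exact ⟨MvPolynomial.C a.re, MvPolynomial.C a.im, fun z => by simp⟩
  | add p q hp hq =>
    obtain ⟨R, S, h⟩ := hp
    obtain ⟨R', S', h'⟩ := hq
    exact ⟨R + R', S + S', fun z => by simp [h z, h' z]⟩
  | mul_X p i hp =>
    obtain ⟨R, S, h⟩ := hp
    exact ⟨R * MvPolynomial.X (Sum.inl i) - S * MvPolynomial.X (Sum.inr i),
      R * MvPolynomial.X (Sum.inr i) + S * MvPolynomial.X (Sum.inl i), fun z => by simp [h z]⟩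

/-- The componentwise exponential. -/
noncomputable def expMap {n : ℕ} (w : Fin n → ℂ) : Fin n → ℂ := fun i => Complex.exp (w i)

/-- The derivative of the componentwise exponential. -/
noncomputable def expDeriv {n : ℕ} (w : Fin n → ℂ) : (Fin n → ℂ) →L[ℂ] (Fin n → ℂ) :=
  ContinuousLinearMap.pi fun i => Complex.exp (w i) • ContinuousLinearMap.proj i

@[simp]
theorem expDeriv_apply {n : ℕ} (w u : Fin n → ℂ) (i : Fin n) :
    expDeriv w u i = Complex.exp (w i) * u i := rfl

theorem continuous_expMap {n : ℕ} : Continuous (expMap (n := n)) :=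
  continuous_pi fun i => Complex.continuous_exp.comp (continuous_apply i)

theorem hasStrictFDerivAt_expMap {n : ℕ} (w : Fin n → ℂ) :
    HasStrictFDerivAt expMap (expDeriv w) w :=
  hasStrictFDerivAt_pi.mpr fun i => (ContinuousLinearMap.proj (R := ℂ)
    (φ := fun _ : Fin n => ℂ) i).hasStrictFDerivAt.cexp

/-- The equations of an étale locus in logarithmic coordinates. -/
noncomputable def HolomorphicSystem.ofEtale {n k : ℕ} (J : Finset (Fin n)) (hJ : J.card = k)
    (P : Fin n → MvPolynomial (Fin n) ℂ)
    (hP : ∀ i ∉ J, ((P i).vars : Set (Fin n)) ⊆ insert i (J : Set (Fin n))) :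
    HolomorphicSystem n k where
  J := J
  card_J := hJ
  g w i := if i ∈ J then 0 else MvPolynomial.eval (expMap w) (P i)
  g' w := ContinuousLinearMap.pi fun i =>
    if i ∈ J then 0 else ((P i).differential (expMap w)).comp (expDeriv w)
  U := {w | ∀ i ∉ J, MvPolynomial.eval (expMap w) (MvPolynomial.pderiv i (P i)) ≠ 0}
  g_apply w i hi := if_pos hi
  g'_apply w u i hi := by simp [hi]
  hasStrictFDerivAt w := by
    refine hasStrictFDerivAt_pi.mpr fun i => ?_
    by_cases hi : i ∈ J
    · simpa [hi] using hasStrictFDerivAt_const (0 : ℂ) w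
    · simp only [hi, if_false]
      exact ((P i).hasStrictFDerivAt_eval _).comp w (hasStrictFDerivAt_expMap w)
  continuous_g' := by
    refine continuous_clm_apply.mpr fun u => continuous_pi fun i => ?_
    by_cases hi : i ∈ J
    · simpa [hi] using continuous_const
    · simp only [ContinuousLinearMap.coe_pi', hi, if_false, ContinuousLinearMap.comp_apply,
        MvPolynomial.differential_apply, expDeriv_apply]
      refine continuous_finsetSum _ fun j _ => ?_
      exact ((MvPolynomial.continuous_eval _).comp continuous_expMap).mul
        ((Complex.continuous_exp.comp (continuous_apply j)).mul continuous_const)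
  isOpen_U := by
    have : {w : Fin n → ℂ | ∀ i ∉ J, MvPolynomial.eval (expMap w)
        (MvPolynomial.pderiv i (P i)) ≠ 0} = ⋂ i ∈ Jᶜ, {w | MvPolynomial.eval (expMap w)
        (MvPolynomial.pderiv i (P i)) ≠ 0} := by
      ext w; simp
    rw [this]
    exact isOpen_biInter_finset fun i _ => isOpen_ne_fun
      ((MvPolynomial.continuous_eval _).comp continuous_expMap) continuous_const
  eq_zero w hw u hu huJ := by
    ext i
    by_cases hi : i ∈ J
    · exact huJ i hi
    have h := congrFun hu i
    simp only [ContinuousLinearMap.coe_pi', hi, if_false, ContinuousLinearMap.comp_apply,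
      MvPolynomial.differential_apply, expDeriv_apply, Pi.zero_apply] at h
    -- Only the `i`-th term survives: `P i` involves just `J` and `i`, and `u` vanishes on `J`.
    rw [Finset.sum_eq_single i] at h
    · have := (mul_eq_zero.mp h).resolve_left (hw i hi)
      exact (mul_eq_zero.mp this).resolve_left (Complex.exp_ne_zero _)
    · intro j _ hj
      by_cases hjJ : j ∈ J
      · rw [huJ j hjJ, mul_zero, mul_zero]
      · rw [MvPolynomial.pderiv_eq_zero_of_notMem_vars fun hjv => ?_, map_zero, zero_mul]
        rcases hP i hi hjv with h' | h'
        · exact hj h'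
        · exact hjJ h'
    · simp

/-- For `y = exp z`, the condition `Im z_a = θ_a` implies `cos θ_a Im y_a - sin θ_a Re y_a = 0`,
which is linear in `y`. The real system has `2(n - k) + 2k = 2n` equations in `2n` unknowns and
degree independent of `I` and `θ`; transversality is nondegeneracy. -/
theorem HolomorphicSystem.exists_card_le_ofEtale {n k : ℕ} (J : Finset (Fin n)) (hJ : J.card = k)
    (P : Fin n → MvPolynomial (Fin n) ℂ)
    (hP : ∀ i ∉ J, ((P i).vars : Set (Fin n)) ⊆ insert i (J : Set (Fin n))) :
    ∃ N : ℕ, ∀ (I : Fin (2 * k) → Fin n) (θ : EuclideanSpace ℝ (Fin (2 * k)))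
      (Z : Finset (Fin n → ℂ)), (∀ z ∈ Z,
        z ∈ (HolomorphicSystem.ofEtale J hJ P hP).locus ∩ argBox n ∧
        (HolomorphicSystem.ofEtale J hJ P hP).IsTransverse I z ∧
        coordSelect I (imMap n z) = θ) → Z.card ≤ N := by
  classical
  set H := HolomorphicSystem.ofEtale J hJ P hP with hH
  choose R S hRS using fun i => (P i).exists_re_im
  let d := ∑ i, ((R i).totalDegree + (S i).totalDegree) + 1
  have hd : ∀ i, (R i).totalDegree + (S i).totalDegree ≤ d := fun i =>
    (Finset.single_le_sum (f := fun i => (R i).totalDegree + (S i).totalDegree)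
      (fun _ _ => Nat.zero_le _) (Finset.mem_univ i)).trans (Nat.le_succ _)
  refine ⟨(Fintype.card (Fin n ⊕ Fin n) * d + 1) ^ Fintype.card (Fin n ⊕ Fin n),
    fun I θ Z hZ => ?_⟩
  -- The half-open box contains one logarithm of each point, so no solutions are lost by passing to
  -- the torus.
  have hexp : InjOn (expMap (n := n)) Z := by
    intro z hz w hw h
    funext i
    exact Complex.exp_inj_of_neg_pi_lt_of_le_pi ((hZ z hz).1.2 i).1 ((hZ z hz).1.2 i).2
      ((hZ w hw).1.2 i).1 ((hZ w hw).1.2 i).2 (congrFun h i)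
  rw [← Finset.card_image_of_injOn hexp]
  let ρ := {i // i ∉ J} ⊕ {i // i ∉ J} ⊕ Fin (2 * k)
  let Q : ρ → MvPolynomial (Fin n ⊕ Fin n) ℝ := Sum.elim (fun i => R i) (Sum.elim (fun i => S i)
    fun a => MvPolynomial.C (Real.cos (θ a)) * MvPolynomial.X (Sum.inr (I a)) -
      MvPolynomial.C (Real.sin (θ a)) * MvPolynomial.X (Sum.inl (I a)))
  let Φ : (Fin n → ℂ) → ρ → ℝ := fun y => Sum.elim (fun i => (MvPolynomial.eval y (P i)).re)
    (Sum.elim (fun i => (MvPolynomial.eval y (P i)).im)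
      fun a => Real.cos (θ a) * (y (I a)).im - Real.sin (θ a) * (y (I a)).re)
  let Φ' : (Fin n → ℂ) → (Fin n → ℂ) →L[ℝ] (ρ → ℝ) := fun y => ContinuousLinearMap.pi
    (Sum.elim (fun i => Complex.reCLM.comp (((P i).differential y).restrictScalars ℝ))
      (Sum.elim (fun i => Complex.imCLM.comp (((P i).differential y).restrictScalars ℝ))
      fun a => Real.cos (θ a) • Complex.imCLM.comp (ContinuousLinearMap.proj (I a)) -
        Real.sin (θ a) • Complex.reCLM.comp (ContinuousLinearMap.proj (I a))))
  have hΦ' : ∀ y, HasStrictFDerivAt Φ (Φ' y) y := by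
    intro y
    refine hasStrictFDerivAt_pi.mpr ?_
    have h := fun i => ((P i).hasStrictFDerivAt_eval y).restrictScalars ℝ
    rintro (i | i | a)
    · exact Complex.reCLM.hasStrictFDerivAt.comp y (h i)
    · exact Complex.imCLM.hasStrictFDerivAt.comp y (h i)
    · exact (Real.cos (θ a) • Complex.imCLM.comp (ContinuousLinearMap.proj (I a)) -
        Real.sin (θ a) • Complex.reCLM.comp
          (ContinuousLinearMap.proj (R := ℝ) (φ := fun _ : Fin n => ℂ) (I a))).hasStrictFDerivAt
  -- This is `Im (e^{-iθ} e^z c) = e^{Re z} Im c` for `θ = Im z`: `c = 1` verifies the equation, and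
  -- `c = v a` translates its derivative back to logarithmic coordinates.
  have htrig : ∀ z : Fin n → ℂ, coordSelect I (imMap n z) = θ → ∀ a (c : ℂ),
      Real.cos (θ a) * (Complex.exp (z (I a)) * c).im -
        Real.sin (θ a) * (Complex.exp (z (I a)) * c).re = Real.exp (z (I a)).re * c.im := by
    rintro z rfl a c
    rw [coordSelect_apply, imMap_apply, Complex.mul_im, Complex.mul_re, Complex.exp_re,
      Complex.exp_im]
    linear_combination Real.exp (z (I a)).re * c.im * Real.sin_sq_add_cos_sq (z (I a)).im
  refine MvPolynomial.card_nondegenerate_zeros_le ?_ (realCoordinates n) Q d ?_ Φ ?_ _ ?_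
  · have hc : Fintype.card {i // i ∉ J} = n - k := by
      rw [Fintype.card_subtype_compl, Fintype.card_fin, Fintype.card_coe, hJ]
    have hkn : k ≤ n := hJ ▸ (Finset.card_le_univ J).trans (by simp)
    simp only [ρ, Fintype.card_sum, hc, Fintype.card_fin]
    omega
  · rintro (i | i | a)
    · exact le_trans (Nat.le_add_right _ _) (hd i)
    · exact le_trans (Nat.le_add_left _ _) (hd i)
    · refine le_trans ?_ (Nat.le_add_left 1 _)
      refine (MvPolynomial.totalDegree_sub _ _).trans (max_le ?_ ?_) <;>
      · refine (MvPolynomial.totalDegree_mul _ _).trans ?_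
        simp
  · rintro y (i | i | a)
    · exact (hRS i y).1
    · exact (hRS i y).2
    · simp [Φ, Q]
  · intro y hy
    obtain ⟨z, hz, rfl⟩ := Finset.mem_image.mp hy
    obtain ⟨⟨hzl, -⟩, htr, hzθ⟩ := hZ z hz
    refine ⟨?_, Φ' _, hΦ' _, (injective_iff_map_eq_zero _).mpr fun u hu => ?_⟩
    · have h0 : ∀ i ∉ J, MvPolynomial.eval (expMap z) (P i) = 0 := fun i hi => by
        have := congrFun hzl.2 i
        simpa [hH, HolomorphicSystem.ofEtale, hi] using this
      funext r
      rcases r with i | i | a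
      · simp [Φ, h0 i i.2]
      · simp [Φ, h0 i i.2]
      · simpa [Φ, expMap] using htrig z hzθ a 1
    · let v : Fin n → ℂ := fun j => (Complex.exp (z j))⁻¹ * u j
      have huv : ∀ j, u j = Complex.exp (z j) * v j := fun j =>
        (mul_inv_cancel_left₀ (Complex.exp_ne_zero _) _).symm
      have huv' : u = expDeriv z v := funext huv
      have hv : v = 0 := by
        apply htr
        · ext i
          by_cases hi : i ∈ J
          · exact H.g'_apply _ _ i hi
          · have h1 := congrFun hu (Sum.inl ⟨i, hi⟩)
            have h2 := congrFun hu (Sum.inr (Sum.inl ⟨i, hi⟩))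
            have h3 : H.g' z v i = (P i).differential (expMap z) u := by
              rw [huv']
              simp [hH, HolomorphicSystem.ofEtale, hi]
            rw [h3]
            exact Complex.ext h1 h2
        · ext a
          have h1 := congrFun hu (Sum.inr (Sum.inr a))
          have h2 : Real.cos (θ a) * (u (I a)).im - Real.sin (θ a) * (u (I a)).re = 0 := h1
          rw [huv, htrig z hzθ] at h2
          exact (mul_eq_zero.mp h2).resolve_left (Real.exp_ne_zero _)
      rw [huv', hv, map_zero]

/-! ### Finite volume of the amoeba -/

theorem Amoeba.vol_amoeba_lt_top {n k : ℕ} (hkn : k ≤ n) {V : Set (Fin n → ℂ)}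
    (hV : V ⊆ Amoeba.complexTorus n) (hdim : Amoeba.dimension V ≤ (k : WithBot ℕ∞)) :
    Amoeba.vol (2 * k) (Amoeba.amoeba V) < ⊤ := by
  obtain ⟨T, hT, hTP, hcov⟩ := MvPolynomial.zeroLocus_subset_iUnion_etaleLocus k
    (by simpa using hkn) (MvPolynomial.vanishingIdeal ℂ V) hdim
  have hfin : ∀ t ∈ T, μHE[2 * k] (Amoeba.Log '' (MvPolynomial.etaleLocus t.1 t.2 ∩
      Amoeba.complexTorus n)) < ⊤ := by
    intro t ht
    obtain ⟨N, hN⟩ := HolomorphicSystem.exists_card_le_ofEtale t.1 (hTP t ht).1 t.2 (hTP t ht).2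
    refine (measure_mono ?_).trans_lt
      (HolomorphicSystem.euclideanHausdorffMeasure_reMap_image_lt_top _ N hN)
    rintro _ ⟨z, ⟨hz, hz0⟩, rfl⟩
    have hexp : expMap (fun i => Complex.log (z i)) = z :=
      funext fun i => Complex.exp_log (hz0 i)
    -- The principal logarithm is the lift of `z` lying in the argument box.
    refine ⟨fun i => Complex.log (z i), ⟨⟨?_, ?_⟩, fun i => ?_⟩, ?_⟩
    · intro i hi
      rw [hexp]
      exact (hz i hi).2
    · ext i
      by_cases hi : i ∈ t.1
      · exact if_pos hi
      · refine (if_neg hi).trans ?_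
        rw [hexp]
        exact (hz i hi).1
    · exact ⟨Complex.neg_pi_lt_log_im _, Complex.log_im_le_pi _⟩
    · ext i
      simp [Amoeba.Log, Complex.log_re]
  refine lt_of_le_of_lt ?_ (measure_biUnion_lt_top hT hfin)
  refine measure_mono ?_
  rintro _ ⟨z, hz, rfl⟩
  obtain ⟨t, ht, hzt⟩ := mem_iUnion₂.mp (hcov (MvPolynomial.zeroLocus_vanishingIdeal_le V hz))
  exact mem_iUnion₂.mpr ⟨t, ht, z, ⟨hzt, hV hz⟩, rfl⟩

theorem mainTheorem5 (n k : ℕ) (hkn : 2 * k ≤ n) (V : Set (Fin n → ℂ))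
    (hV : Amoeba.IsAlgebraicSubvariety V) (hdim : Amoeba.dimension V = (k : WithBot ℕ∞)) :
    Amoeba.vol (2 * k) (Amoeba.amoeba V) < ⊤ := by
  obtain ⟨I, rfl⟩ := hV
  exact Amoeba.vol_amoeba_lt_top (by omega) inter_subset_right hdim.le
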